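/- Let $G$ be a compact connected simple Lie group with Lie algebra $\mathfrak g$, equipped with an invariant inner product $\langle\cdot,\cdot\rangle$. Let $\theta_1,\theta_2$ be commuting involutions (smooth automorphisms of order two) of $G$; denote their differentials on $\mathfrak g$ by the same symbols, and let $\mathfrak m_i=\{X\in\mathfrak g\mid\theta_i(X)=-X\}$. Let $\mathfrak a$ be a maximal abelian subspace of $\mathfrak m_1$, and suppose that $\theta_2=\tau_{\exp Y}\,\theta_1\,\tau_{\exp Y}^{-1}$ for some $Y\in\mathfrak a$, where $\tau_g(x)=gxg^{-1}$ (so $\theta_1$ and $\theta_2$ are conjugate by an inner automorphism). For $\alpha\in\mathfrak a$ and $\epsilon=\pm1$ put $$\mathfrak g(\mathfrak a,\alpha)=\{X\in\mathfrak g^{\mathbb C}\mid [H,X]=\sqrt{-1}\,\langle\alpha,H\rangle X\ (H\in\mathfrak a)\},\qquad \mathfrak g(\mathfrak a,\alpha,\epsilon)=\{X\in\mathfrak g(\mathfrak a,\alpha)\mid\theta_1\theta_2(X)=\epsilon X\}.$$ Let $\bar\Sigma=\{\lambda\in\mathfrak a\setminus\{0\}\mid\mathfrak g(\mathfrak a,\lambda)\ne0\}$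 be the restricted root system of $(G,\theta_1)$, with multiplicities $\bar m_\lambda=\dim_{\mathbb C}\mathfrak g(\mathfrak a,\lambda)$. Let $(\tilde\Sigma,\Sigma,W;m,n)$ be the data constructed from $(G,\theta_1,\theta_2)$ and $\mathfrak a$: $$\tilde\Sigma=\{\alpha\in\mathfrak a\setminus\{0\}\mid\mathfrak g(\mathfrak a,\alpha)\neq0\},\quad \Sigma=\{\alpha\in\tilde\Sigma\mid\mathfrak g(\mathfrak a,\alpha,1)\ne0\},\quad W=\{\alpha\in\tilde\Sigma\mid\mathfrak g(\mathfrak a,\alpha,-1)\ne0\},$$ $$m(\alpha)=\dim_{\mathbb C}\mathfrak g(\mathfrak a,\alpha,1),\qquad n(\alpha)=\dim_{\mathbb C}\mathfrak g(\mathfrak a,\alpha,-1).$$ Then $\mathfrak a$ is a maximal abelian subspace of $\mathfrak m_1\cap\mathfrak m_2$; $Y$ lies in the lattice $\Gamma=\{X\in\mathfrak a\mid\langle\lambda,X\rangle\in\tfrac{\pi}{2}\mathbb Z\ (\lambda\in\bar\Sigma)\}$; and $(\tilde\Sigma,\Sigma,W;m,n)$ is the symmetric triad of type (IV) with multiplicities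 of $\mathfrak a$ with base $(\bar\Sigma;\bar m)$ determined by $Y$. That is: 1. $\bar\Sigma$ is an irreducible (nonempty, possibly non-reduced) root system of $\mathfrak a$, and $\bar m$ is positive on $\bar\Sigma$ and satisfies $\bar m_{w_\alpha\beta}=\bar m_\beta$ for $\alpha,\beta\in\bar\Sigma$, where $w_\alpha$ is the reflection in $\alpha$; 2. $\tilde\Sigma=\bar\Sigma$, $\ \Sigma=\Sigma_Y:=\{\lambda\in\bar\Sigma\mid\langle\lambda,2Y\rangle\in2\pi\mathbb Z\}$, and $W=W_Y:=\{\lambda\in\bar\Sigma\mid\langle\lambda,2Y\rangle\in\pi+2\pi\mathbb Z\}=\bar\Sigma\setminus\Sigma_Y$; 3. $(m(\lambda),n(\lambda))=(\bar m_\lambda,0)$ for $\lambda\in\Sigma_Y$, and $(m(\lambda),n(\lambda))=(0,\bar m_\lambda)$ for $\lambda\in W_Y$. In particular, if $Y=0$, then $\theta_1=\theta_2$ and $(\tilde\Sigma,\Sigma,W)=(\bar\Sigma,\bar\Sigma,\emptyset)$. -/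

import Mathlib

open scoped Manifold ContDiff TensorProduct

namespace SymTriad

/-! ### Root systems and triads of type (IV), inside a subspace `a` of a real vector space `V`

The inner product is an explicit bilinear form `B` on `V`; roots are vectors of `a`. -/

section RootSystems

variable {V : Type*} [AddCommGroup V] [Module ℝ V]

/-- `B` is a (positive definite, symmetric) inner product on `V`. -/
structure IsInnerProduct (B : LinearMap.BilinForm ℝ V) : Prop where
  symm : ∀ x y, B x y = B y x
  pos : ∀ x, x ≠ 0 → 0 < B x x

/-- The reflection `w_α(H) = H - 2 (⟨α, H⟩ / ‖α‖²) α`. -/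
noncomputable def reflection (B : LinearMap.BilinForm ℝ V) (α H : V) : V :=
  H - (2 * B α H / B α α) • α

/-- `Δ` is a (possibly non-reduced) root system of the subspace `a` with inner product `B`. -/
structure IsRootSystem (B : LinearMap.BilinForm ℝ V) (a : Submodule ℝ V) (Δ : Set V) : Prop where
  finite : Δ.Finite
  zero_notMem : (0 : V) ∉ Δ
  span_eq : Submodule.span ℝ Δ = a
  reflection_mem : ∀ α ∈ Δ, ∀ β ∈ Δ, reflection B α β ∈ Δ
  integral : ∀ α ∈ Δ, ∀ β ∈ Δ, ∃ k : ℤ, 2 * B α β / B α α = k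

/-- `Δ` is a disjoint union of two nonempty mutually orthogonal subsets. -/
def IsReducible (B : LinearMap.BilinForm ℝ V) (Δ : Set V) : Prop :=
  ∃ Δ₁ Δ₂ : Set V, Δ₁.Nonempty ∧ Δ₂.Nonempty ∧ Δ = Δ₁ ∪ Δ₂ ∧ Δ₁ ∩ Δ₂ = ∅ ∧
    ∀ α ∈ Δ₁, ∀ β ∈ Δ₂, B α β = 0

/-- `Δ` is an irreducible root system of `a`. -/
structure IsIrreducibleRootSystem (B : LinearMap.BilinForm ℝ V) (a : Submodule ℝ V)
    (Δ : Set V) : Prop where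
  isRootSystem : IsRootSystem B a Δ
  nonempty : Δ.Nonempty
  not_reducible : ¬ IsReducible B Δ

/-- `m` is a multiplicity on the root system `Δ`: positive, and invariant under the reflections
in the roots.  Only the values of `m` on `Δ` are relevant. -/
structure IsRootMultiplicity (B : LinearMap.BilinForm ℝ V) (Δ : Set V) (m : V → ℝ) : Prop where
  pos : ∀ α ∈ Δ, 0 < m α
  reflection_eq : ∀ α ∈ Δ, ∀ β ∈ Δ, m (reflection B α β) = m β

/-- The lattice `Γ = {X ∈ a | ⟨λ, X⟩ ∈ (π/2)ℤ for all λ ∈ Δ}`. -/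
def latticeΓ (B : LinearMap.BilinForm ℝ V) (a : Submodule ℝ V) (Δ : Set V) : Set V :=
  {X | X ∈ a ∧ ∀ l ∈ Δ, ∃ k : ℤ, B l X = Real.pi / 2 * k}

/-- `Σ_Y = {λ ∈ Δ | ⟨λ, 2Y⟩ ∈ 2πℤ}`. -/
def sigmaAt (B : LinearMap.BilinForm ℝ V) (Δ : Set V) (Y : V) : Set V :=
  {l | l ∈ Δ ∧ ∃ k : ℤ, B l ((2 : ℝ) • Y) = 2 * Real.pi * k}

/-- `W_Y = {λ ∈ Δ | ⟨λ, 2Y⟩ ∈ π + 2πℤ}`. -/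
def wAt (B : LinearMap.BilinForm ℝ V) (Δ : Set V) (Y : V) : Set V :=
  {l | l ∈ Δ ∧ ∃ k : ℤ, B l ((2 : ℝ) • Y) = Real.pi + 2 * Real.pi * k}

/-- The data `(Σ̃, Σ, W; m, n)`.  Only the values of `m` and `n` on `Σ̃` are relevant. -/
structure Triad (V : Type*) where
  tildeSigma : Set V
  sigma : Set V
  w : Set V
  m : V → ℝ
  n : V → ℝ

/-- `T = (Σ̃, Σ, W; m, n)` is the symmetric triad of type (IV) with multiplicities of `a` which is
determined by the base `(Δ; mult)` and the element `Y` of the lattice `Γ` of `Δ`. -/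
structure IsTypeIVWith (B : LinearMap.BilinForm ℝ V) (a : Submodule ℝ V) (T : Triad V)
    (Δ : Set V) (mult : V → ℝ) (Y : V) : Prop where
  irreducible : IsIrreducibleRootSystem B a Δ
  isMultiplicity : IsRootMultiplicity B Δ mult
  mem_lattice : Y ∈ latticeΓ B a Δ
  tildeSigma_eq : T.tildeSigma = Δ
  sigma_eq : T.sigma = sigmaAt B Δ Y
  w_eq : T.w = wAt B Δ Y
  w_eq_diff : T.w = Δ \ sigmaAt B Δ Y
  m_sigma : ∀ l ∈ T.sigma, T.m l = mult l
  n_sigma : ∀ l ∈ T.sigma, T.n l = 0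
  m_w : ∀ l ∈ T.w, T.m l = 0
  n_w : ∀ l ∈ T.w, T.n l = mult l

/-- `T` is a symmetric triad of type (IV) with multiplicities of `a`. -/
def IsTypeIV (B : LinearMap.BilinForm ℝ V) (a : Submodule ℝ V) (T : Triad V) : Prop :=
  ∃ (mult : V → ℝ) (Y : V), IsTypeIVWith B a T T.tildeSigma mult Y

end RootSystems

/-! ### The constructions from a real Lie algebra with involutions -/

section LieAlgebras

variable {g : Type*} [LieRing g] [LieAlgebra ℝ g]

/-- `B` is an invariant inner product on the Lie algebra `g`: all `ad X` are skew-symmetric. -/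
structure IsInvariantInnerProduct (B : LinearMap.BilinForm ℝ g) : Prop where
  isInnerProduct : IsInnerProduct B
  invariant : ∀ X Y Z : g, B ⁅X, Y⁆ Z = - B Y ⁅X, Z⁆

/-- The `(-1)`-eigenspace `m` of an involution of `g`. -/
def minusPart (t : g →ₗ[ℝ] g) : Submodule ℝ g :=
  Module.End.eigenspace t (-1)

/-- `a` is a maximal abelian subspace of `p`. -/
def IsMaximalAbelian (p a : Submodule ℝ g) : Prop :=
  Maximal (fun b : Submodule ℝ g => b ≤ p ∧ ∀ X ∈ b, ∀ Y ∈ b, ⁅X, Y⁆ = 0) a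

/-- `g(a, α) = {X ∈ g^ℂ | [H, X] = √-1 ⟨α, H⟩ X for all H ∈ a}`. -/
noncomputable def rootSpace (B : LinearMap.BilinForm ℝ g) (a : Submodule ℝ g) (α : g) :
    Submodule ℂ (ℂ ⊗[ℝ] g) where
  carrier := {X | ∀ H ∈ a, LieAlgebra.ad ℂ (ℂ ⊗[ℝ] g) ((1 : ℂ) ⊗ₜ[ℝ] H) X =
    (Complex.I * (B α H : ℂ)) • X}
  add_mem' := by
    intro X Y hX hY H hH
    rw [map_add, hX H hH, hY H hH, smul_add]
  zero_mem' := by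
    intro H _
    rw [map_zero, smul_zero]
  smul_mem' := by
    intro c X hX H hH
    rw [map_smul, hX H hH, smul_comm]

/-- `g(a, α, ε) = {X ∈ g(a, α) | t X = ε X}`, for the complex-linear extension of `t`. -/
noncomputable def rootSpaceEps (B : LinearMap.BilinForm ℝ g) (a : Submodule ℝ g)
    (t : g →ₗ[ℝ] g) (α : g) (ε : ℂ) : Submodule ℂ (ℂ ⊗[ℝ] g) :=
  rootSpace B a α ⊓ Module.End.eigenspace (t.baseChange ℂ) ε

/-- The restricted roots with respect to `a`: the nonzero `α ∈ a` with `g(a, α) ≠ 0`. -/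
def restrictedRoots (B : LinearMap.BilinForm ℝ g) (a : Submodule ℝ g) : Set g :=
  {α | α ∈ a ∧ α ≠ 0 ∧ rootSpace B a α ≠ ⊥}

/-- The multiplicity of a restricted root `α`: the complex dimension of `g(a, α)`. -/
noncomputable def restrictedMult (B : LinearMap.BilinForm ℝ g) (a : Submodule ℝ g) (α : g) : ℝ :=
  (Module.finrank ℂ (rootSpace B a α) : ℝ)

/-- The data `(Σ̃, Σ, W; m, n)` constructed from the involutions `t₁`, `t₂` of `g` and `a`. -/
noncomputable def triadOf (B : LinearMap.BilinForm ℝ g) (a : Submodule ℝ g)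
    (t₁ t₂ : g →ₗ[ℝ] g) : Triad g where
  tildeSigma := {α | α ∈ a ∧ α ≠ 0 ∧ rootSpace B a α ≠ ⊥}
  sigma := {α | α ∈ a ∧ α ≠ 0 ∧ rootSpace B a α ≠ ⊥ ∧ rootSpaceEps B a (t₁ ∘ₗ t₂) α 1 ≠ ⊥}
  w := {α | α ∈ a ∧ α ≠ 0 ∧ rootSpace B a α ≠ ⊥ ∧ rootSpaceEps B a (t₁ ∘ₗ t₂) α (-1) ≠ ⊥}
  m α := (Module.finrank ℂ (rootSpaceEps B a (t₁ ∘ₗ t₂) α 1) : ℝ)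
  n α := (Module.finrank ℂ (rootSpaceEps B a (t₁ ∘ₗ t₂) α (-1)) : ℝ)

end LieAlgebras

/-! ### Lie groups -/

section LieGroups

/-- A smooth real Lie group is smooth enough for its Lie algebra to be defined. -/
instance : ENat.LEInfty (minSmoothness ℝ 3) :=
  ⟨by rw [minSmoothness_of_isRCLikeNormedField]; exact ENat.LEInfty.out⟩

variable {E : Type*} [NormedAddCommGroup E] [NormedSpace ℝ E]
  {G : Type*} [TopologicalSpace G] [ChartedSpace E G] [Group G] [LieGroup 𝓘(ℝ, E) ∞ G]

variable (E) in
/-- An involution of the Lie group `G`: a smooth automorphism of order two. -/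
structure IsInvolution (t : MulAut G) : Prop where
  contMDiff : ContMDiff 𝓘(ℝ, E) 𝓘(ℝ, E) ∞ (fun x : G => t x)
  mul_self : t * t = 1
  ne_one : t ≠ 1

variable (E) in
/-- The differential at the identity of an automorphism `t` of `G`, as a linear map of the Lie
algebra of `G` to itself (recall that `t 1 = 1`). -/
noncomputable def differential (t : MulAut G) :
    GroupLieAlgebra 𝓘(ℝ, E) G →ₗ[ℝ] GroupLieAlgebra 𝓘(ℝ, E) G :=
  (show GroupLieAlgebra 𝓘(ℝ, E) G →L[ℝ] GroupLieAlgebra 𝓘(ℝ, E) G from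
    mfderiv 𝓘(ℝ, E) 𝓘(ℝ, E) (fun x : G => t x) (1 : G)).toLinearMap

/-- `y = exp X`: there is a smooth one-parameter subgroup `c` of `G` with velocity `X` at `0` and
`c 1 = y`. -/
def IsExp (X : GroupLieAlgebra 𝓘(ℝ, E) G) (y : G) : Prop :=
  ∃ c : ℝ → G, ContMDiff 𝓘(ℝ, ℝ) 𝓘(ℝ, E) ∞ c ∧ (∀ s t : ℝ, c (s + t) = c s * c t) ∧
    (mfderiv 𝓘(ℝ, ℝ) 𝓘(ℝ, E) c 0 (1 : ℝ) : E) = X ∧ c 1 = y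

end LieGroups

end SymTriad

open SymTriad

/-!
Since `Y ∈ a` and `θ₁` is `-1` on `a`, the operator `exp (ad Y)` is the scalar `exp (i⟨α, Y⟩)` on
`g(a, α)`, and `θ₁` maps `g(a, α)` to `g(a, -α)`. Hence for `θ₂ = exp (ad Y) θ₁ exp (ad Y)⁻¹` the
composite `θ₁θ₂` is the scalar `exp (-i⟨α, 2Y⟩)` on `g(a, α)`; being an involution, it forces
`⟨α, 2Y⟩ ∈ πℤ`, and the parity of `⟨α, 2Y⟩ / π` decides between `Σ` and `W`.

For the root system itself, a root vector of `α` yields `S` fixed by `θ₁` and `T` negated by `θ₁`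
which together with `α` span a copy of `su(2)`. For a suitable multiple `X` of `S` the inner
automorphism `exp (ad X)` acts on `a` as the reflection in `α`. It satisfies quaternion relations
with `exp (ad Z)`, where `Z = (π / ⟨α, α⟩) α`; these give `exp (ad Z) ^ 4 = 1`, which is
integrality. If the roots split orthogonally, the centralizer of one part is an ideal, so simplicity
gives irreducibility.

What is needed from the group is `Ad (exp Y) = exp (ad Y)`. Differentiating
`y * x = (y * x * y⁻¹) * y` in a chart at `1` shows that the derivative of `Ad` at `1` is the
antisymmetrized mixed second derivative of the multiplication, which is the Lie bracket.
-/

namespace SymTriad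

section Complexification

variable {V : Type*} [AddCommGroup V] [Module ℝ V]

variable (V) in
/-- The real part of a vector of the complexification `ℂ ⊗[ℝ] V`. -/
noncomputable def complexRe : ℂ ⊗[ℝ] V →ₗ[ℝ] V :=
  (TensorProduct.lid ℝ V).toLinearMap ∘ₗ Complex.reLm.rTensor V

variable (V) in
/-- The imaginary part of a vector of the complexification `ℂ ⊗[ℝ] V`. -/
noncomputable def complexIm : ℂ ⊗[ℝ] V →ₗ[ℝ] V :=
  (TensorProduct.lid ℝ V).toLinearMap ∘ₗ Complex.imLm.rTensor V

@[simp] theorem complexRe_tmul (c : ℂ) (x : V) : complexRe V (c ⊗ₜ x) = c.re • x := by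
  simp [complexRe]

@[simp] theorem complexIm_tmul (c : ℂ) (x : V) : complexIm V (c ⊗ₜ x) = c.im • x := by
  simp [complexIm]

theorem one_tmul_complexRe_add_I_tmul_complexIm (z : ℂ ⊗[ℝ] V) :
    (1 : ℂ) ⊗ₜ complexRe V z + Complex.I ⊗ₜ complexIm V z = z := by
  induction z with
  | zero => simp
  | add x y hx hy =>
    conv_rhs => rw [← hx, ← hy]
    simp only [map_add, TensorProduct.tmul_add]
    abel
  | tmul c x =>
    simp only [complexRe_tmul, complexIm_tmul, ← TensorProduct.smul_tmul,
      ← TensorProduct.add_tmul]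
    congr 1
    apply Complex.ext <;> simp

theorem complexification_ext_iff {z w : ℂ ⊗[ℝ] V} :
    z = w ↔ complexRe V z = complexRe V w ∧ complexIm V z = complexIm V w := by
  refine ⟨fun h => by simp [h], fun ⟨hre, him⟩ => ?_⟩
  rw [← one_tmul_complexRe_add_I_tmul_complexIm z, hre, him,
    one_tmul_complexRe_add_I_tmul_complexIm]

theorem complexRe_smul (c : ℂ) (z : ℂ ⊗[ℝ] V) :
    complexRe V (c • z) = c.re • complexRe V z - c.im • complexIm V z := by
  induction z with
  | zero => simp
  | add x y hx hy => simp only [smul_add, map_add, hx, hy]; module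
  | tmul d x => simp only [TensorProduct.smul_tmul', complexRe_tmul, complexIm_tmul,
      smul_eq_mul, Complex.mul_re]; module

theorem complexIm_smul (c : ℂ) (z : ℂ ⊗[ℝ] V) :
    complexIm V (c • z) = c.re • complexIm V z + c.im • complexRe V z := by
  induction z with
  | zero => simp
  | add x y hx hy => simp only [smul_add, map_add, hx, hy]; module
  | tmul d x => simp only [TensorProduct.smul_tmul', complexRe_tmul, complexIm_tmul,
      smul_eq_mul, Complex.mul_im]; module

@[simp] theorem complexRe_baseChange (f : Module.End ℝ V) (z : ℂ ⊗[ℝ] V) :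
    complexRe V (f.baseChange ℂ z) = f (complexRe V z) := by
  induction z with
  | zero => simp
  | add x y hx hy => simp only [map_add, hx, hy]
  | tmul d x => simp

@[simp] theorem complexIm_baseChange (f : Module.End ℝ V) (z : ℂ ⊗[ℝ] V) :
    complexIm V (f.baseChange ℂ z) = f (complexIm V z) := by
  induction z with
  | zero => simp
  | add x y hx hy => simp only [map_add, hx, hy]
  | tmul d x => simp

end Complexification

section Exponential

open scoped Nat

variable {V : Type*} [AddCommGroup V] [Module ℝ V] [FiniteDimensional ℝ V]

/-- The exponential of an endomorphism of a finite-dimensional real vector space.  It is computed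
on matrices, so that the space needs no topology. -/
noncomputable def expEnd (A : Module.End ℝ V) : Module.End ℝ V :=
  (algEquivMatrix (Module.finBasis ℝ V)).symm
    (NormedSpace.exp (algEquivMatrix (Module.finBasis ℝ V) A))

@[simp] theorem expEnd_zero : expEnd (0 : Module.End ℝ V) = 1 := by
  simp [expEnd]

theorem expEnd_add_of_commute {A A' : Module.End ℝ V} (h : Commute A A') :
    expEnd (A + A') = expEnd A * expEnd A' := by
  rw [expEnd, map_add, Matrix.exp_add_of_commute _ _ (h.map _), map_mul]
  rfl

theorem expEnd_mul_expEnd_neg (A : Module.End ℝ V) : expEnd A * expEnd (-A) = 1 := by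
  rw [← expEnd_add_of_commute (Commute.refl A).neg_right, add_neg_cancel, expEnd_zero]

open scoped Matrix.Norms.Operator in
theorem hasSum_expEnd {F : Type*} [AddCommGroup F] [TopologicalSpace F] [IsTopologicalAddGroup F]
    [Module ℝ F] [ContinuousSMul ℝ F] (L : Module.End ℝ V →ₗ[ℝ] F) (A : Module.End ℝ V) :
    HasSum (fun n : ℕ => (n ! : ℝ)⁻¹ • L (A ^ n)) (L (expEnd A)) := by
  let e := algEquivMatrix (Module.finBasis ℝ V)
  let L' := L ∘ₗ e.symm.toLinearMap
  have hcont : Continuous L' := L'.continuous_of_finiteDimensional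
  have hsum := (NormedSpace.exp_series_hasSum_exp' (𝕂 := ℝ) (e A)).map L' hcont
  simp only [Function.comp_def, L', LinearMap.comp_apply, map_smul, map_pow,
    AlgEquiv.toLinearMap_apply, AlgEquiv.symm_apply_apply] at hsum
  exact hsum

theorem comp_expEnd_of_comp_eq {W : Type*} [AddCommGroup W] [Module ℝ W] [FiniteDimensional ℝ W]
    {P : V →ₗ[ℝ] W} {A : Module.End ℝ V} {A' : Module.End ℝ W} (h : P ∘ₗ A = A' ∘ₗ P) :
    P ∘ₗ expEnd A = expEnd A' ∘ₗ P := by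
  have hpow (n : ℕ) (x : V) : P ((A ^ n) x) = (A' ^ n) (P x) := by
    induction n generalizing x with
    | zero => rfl
    | succ n ih =>
      rw [pow_succ, pow_succ, Module.End.mul_apply, Module.End.mul_apply, ih]
      exact congrArg _ (LinearMap.congr_fun h x)
  ext x
  rw [← sub_eq_zero, ← Module.forall_dual_apply_eq_zero_iff ℝ]
  intro f
  have hl := hasSum_expEnd (f ∘ₗ P ∘ₗ LinearMap.applyₗ x) A
  have hr := hasSum_expEnd (f ∘ₗ LinearMap.applyₗ (P x)) A'
  simp only [LinearMap.comp_apply, LinearMap.applyₗ_apply_apply, hpow] at hl hr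
  rw [map_sub, sub_eq_zero]
  exact hl.unique hr

theorem expEnd_bilin {V' W : Type*} [AddCommGroup V'] [Module ℝ V'] [FiniteDimensional ℝ V']
    [AddCommGroup W] [Module ℝ W] [FiniteDimensional ℝ W] {A : Module.End ℝ V}
    {A' : Module.End ℝ V'} {D : Module.End ℝ W} (br : V →ₗ[ℝ] V' →ₗ[ℝ] W)
    (hD : ∀ x y, D (br x y) = br (A x) y + br x (A' y)) (x : V) (y : V') :
    expEnd D (br x y) = br (expEnd A x) (expEnd A' y) := by
  have hleft (x : V) (y : V') : expEnd (A.rTensor V') (x ⊗ₜ y) = expEnd A x ⊗ₜ y :=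
    (LinearMap.congr_fun (comp_expEnd_of_comp_eq (P := (TensorProduct.mk ℝ V V').flip y)
      (A := A) (A' := A.rTensor V') (by ext; simp)) x).symm
  have hright : expEnd (A'.lTensor V) (x ⊗ₜ y) = x ⊗ₜ expEnd A' y :=
    (LinearMap.congr_fun (comp_expEnd_of_comp_eq (P := TensorProduct.mk ℝ V V' x)
      (A := A') (A' := A'.lTensor V) (by ext; simp)) y).symm
  have hcomm : Commute (A.rTensor V') (A'.lTensor V) := by
    ext; simp
  have hbr := comp_expEnd_of_comp_eq (P := TensorProduct.lift br)
    (A := A.rTensor V' + A'.lTensor V) (A' := D) (by ext x y; simp [hD])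
  simpa [expEnd_add_of_commute hcomm, hleft, hright] using
    (LinearMap.congr_fun hbr (x ⊗ₜ y)).symm

theorem baseChange_expEnd_apply_of_eigenvector {A : Module.End ℝ V} {z : ℂ ⊗[ℝ] V} {μ : ℂ}
    (hz : A.baseChange ℂ z = μ • z) : (expEnd A).baseChange ℂ z = Complex.exp μ • z := by
  rw [← sub_eq_zero, ← Module.forall_dual_apply_eq_zero_iff ℂ]
  intro f
  have hpow (n : ℕ) : (A ^ n).baseChange ℂ z = μ ^ n • z := by
    induction n with
    | zero => simp [Module.End.one_eq_id]
    | succ n ih =>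
      rw [LinearMap.baseChange_pow] at ih ⊢
      rw [pow_succ, Module.End.mul_apply, hz, map_smul, ih, smul_smul, pow_succ']
  let L : Module.End ℝ V →ₗ[ℝ] ℂ := f.restrictScalars ℝ ∘ₗ
    (LinearMap.applyₗ z).restrictScalars ℝ ∘ₗ LinearMap.baseChangeHom ℝ ℂ V V
  have hl : HasSum (fun n : ℕ => (n ! : ℝ)⁻¹ • f ((A ^ n).baseChange ℂ z))
      (f ((expEnd A).baseChange ℂ z)) := hasSum_expEnd L A
  have hr := (NormedSpace.exp_series_hasSum_exp' (𝕂 := ℝ) μ).mul_right (f z)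
  simp only [hpow, map_smul, smul_eq_mul] at hl
  simp only [smul_mul_assoc, ← Complex.exp_eq_exp_ℂ] at hr
  rw [map_sub, map_smul, smul_eq_mul, sub_eq_zero]
  exact hl.unique hr

theorem toContinuousLinearMap_expEnd {E : Type*} [NormedAddCommGroup E] [NormedSpace ℝ E]
    [FiniteDimensional ℝ E] (A : Module.End ℝ E) :
    LinearMap.toContinuousLinearMap (expEnd A) =
      NormedSpace.exp (LinearMap.toContinuousLinearMap A) := by
  have := FiniteDimensional.complete ℝ E
  have hpow (n : ℕ) : LinearMap.toContinuousLinearMap (A ^ n) =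
      LinearMap.toContinuousLinearMap A ^ n :=
    map_pow (Module.End.toContinuousLinearMap E) A n
  have hl := hasSum_expEnd LinearMap.toContinuousLinearMap.toLinearMap A
  simp only [LinearEquiv.coe_coe, hpow] at hl
  exact hl.unique (NormedSpace.exp_series_hasSum_exp' _)

end Exponential

section InnerProduct

variable {V : Type*} [AddCommGroup V] [Module ℝ V] {B : LinearMap.BilinForm ℝ V}

namespace IsInnerProduct

theorem apply_self_nonneg (hB : IsInnerProduct B) (x : V) : 0 ≤ B x x := by
  rcases eq_or_ne x 0 with rfl | hx
  · simp
  · exact (hB.pos x hx).le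

theorem eq_zero_of_apply_self (hB : IsInnerProduct B) {x : V} (h : B x x = 0) : x = 0 := by
  by_contra hx
  exact (hB.pos x hx).ne' h

theorem isRefl (hB : IsInnerProduct B) : B.IsRefl := fun x y hxy => by rw [hB.symm, hxy]

theorem restrict_nondegenerate (hB : IsInnerProduct B) (a : Submodule ℝ V) :
    (B.restrict a).Nondegenerate :=
  ⟨fun x hx => Subtype.ext (hB.eq_zero_of_apply_self (hx x)),
    fun x hx => Subtype.ext (hB.eq_zero_of_apply_self (hx x))⟩

theorem eq_of_forall_mem_apply_eq (hB : IsInnerProduct B) {a : Submodule ℝ V} {x y : V}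
    (hx : x ∈ a) (hy : y ∈ a) (h : ∀ z ∈ a, B x z = B y z) : x = y := by
  refine sub_eq_zero.1 (hB.eq_zero_of_apply_self ?_)
  rw [map_sub B, LinearMap.sub_apply, h _ (a.sub_mem hx hy), sub_self]

theorem exists_mem_forall_eq_apply [FiniteDimensional ℝ V] (hB : IsInnerProduct B)
    {a : Submodule ℝ V} (f : Module.Dual ℝ a) : ∃ α ∈ a, ∀ z : a, f z = B α z :=
  ⟨((B.restrict a).toDual (hB.restrict_nondegenerate a)).symm f, Subtype.prop _,
    fun z => (LinearMap.BilinForm.apply_toDual_symm_apply (B := B.restrict a) f z).symm⟩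

theorem isSemisimple_of_skew [FiniteDimensional ℝ V] (hB : IsInnerProduct B)
    {A : Module.End ℝ V} (hA : ∀ x y, B (A x) y = -B x (A y)) : A.IsSemisimple := by
  refine Module.End.isSemisimple_iff.2 fun p hp => ⟨B.orthogonal p, fun x hx y hy => ?_,
    LinearMap.BilinForm.isCompl_orthogonal_of_restrict_nondegenerate hB.isRefl
      (hB.restrict_nondegenerate p)⟩
  rw [← neg_eq_zero, ← hA]
  exact hx _ (hp hy)

theorem re_eq_zero_of_skew (hB : IsInnerProduct B) {A : Module.End ℝ V}
    (hA : ∀ x y, B (A x) y = -B x (A y)) {μ : ℂ} {z : ℂ ⊗[ℝ] V} (hz0 : z ≠ 0)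
    (hz : A.baseChange ℂ z = μ • z) : μ.re = 0 := by
  set x := complexRe V z
  set y := complexIm V z
  obtain ⟨hAx, hAy⟩ : A x = μ.re • x - μ.im • y ∧ A y = μ.re • y + μ.im • x := by
    simpa [complexification_ext_iff, complexRe_smul, complexIm_smul] using hz
  have hxx := hA x x
  have hyy := hA y y
  simp only [hAx, hAy, map_add, map_sub, map_smul, LinearMap.add_apply, LinearMap.sub_apply,
    LinearMap.smul_apply, smul_eq_mul, hB.symm y x] at hxx hyy
  have hnorm : μ.re * (B x x + B y y) = 0 := by linarith
  refine (mul_eq_zero.1 hnorm).resolve_right fun h0 => hz0 ?_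
  have hx0 := hB.apply_self_nonneg x
  have hy0 := hB.apply_self_nonneg y
  rw [complexification_ext_iff, map_zero, map_zero]
  exact ⟨hB.eq_zero_of_apply_self (by linarith), hB.eq_zero_of_apply_self (by linarith)⟩

end IsInnerProduct

theorem isSemisimple_baseChange {K L M : Type*} [Field K] [PerfectField K]
    [Field L] [Algebra K L] [AddCommGroup M] [Module K M] [FiniteDimensional K M]
    {A : Module.End K M} (hA : A.IsSemisimple) : Module.End.IsSemisimple (A.baseChange L) := by
  refine Module.End.isSemisimple_of_squarefree_aeval_eq_zero
    (p := (minpoly K A).map (algebraMap K L)) ?_ ?_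
  · exact (PerfectField.separable_iff_squarefree.2 hA.minpoly_squarefree).map.squarefree
  · rw [Polynomial.aeval_map_algebraMap]
    have := Polynomial.aeval_algHom_apply (Module.End.baseChangeHom K L M) A (minpoly K A)
    rw [minpoly.aeval, map_zero] at this
    exact this

theorem reflection_mem_of_mem {a : Submodule ℝ V} {α H : V} (hα : α ∈ a) (hH : H ∈ a) :
    reflection B α H ∈ a :=
  a.sub_mem hH (a.smul_mem _ hα)

theorem reflection_smul_self {α : V} (hα : B α α ≠ 0) (c : ℝ) :
    reflection B α (c • α) = -(c • α) := by
  rw [reflection, map_smul, smul_eq_mul, mul_div_assoc, mul_div_cancel_right₀ _ hα]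
  module

theorem reflection_reflection {α : V} (hα : B α α ≠ 0) (H : V) :
    reflection B α (reflection B α H) = H := by
  have h1 : B α (reflection B α H) = -B α H := by
    rw [reflection, map_sub, map_smul, smul_eq_mul, div_mul_cancel₀ _ hα]
    ring
  rw [reflection, h1, reflection]
  module

theorem IsInnerProduct.apply_reflection_left (hB : IsInnerProduct B) (α β H : V) :
    B (reflection B α β) H = B β (reflection B α H) := by
  simp only [reflection, map_sub, map_smul, LinearMap.sub_apply, LinearMap.smul_apply, smul_eq_mul]
  rw [hB.symm β α]
  ring

end InnerProduct

section InnerAutomorphisms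

variable {g : Type*} [LieRing g] [LieAlgebra ℝ g] [FiniteDimensional ℝ g]

/-- The inner automorphism `exp (ad X)` of a finite-dimensional real Lie algebra. -/
noncomputable def expAd (X : g) : g ≃ₗ⁅ℝ⁆ g where
  toLinearMap := expEnd (LieAlgebra.ad ℝ g X)
  map_lie' {Z Z'} := expEnd_bilin (LieAlgebra.ad ℝ g : g →ₗ[ℝ] Module.End ℝ g)
    (fun x y => by simp) Z Z'
  invFun := expEnd (-LieAlgebra.ad ℝ g X)
  left_inv Z := by
    have h := expEnd_mul_expEnd_neg (-LieAlgebra.ad ℝ g X)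
    rw [neg_neg] at h
    exact LinearMap.congr_fun h Z
  right_inv Z := by
    have h := expEnd_mul_expEnd_neg (LieAlgebra.ad ℝ g X)
    exact LinearMap.congr_fun h Z

theorem expAd_apply (X Z : g) : expAd X Z = expEnd (LieAlgebra.ad ℝ g X) Z := rfl

theorem expAd_zero_apply (Z : g) : expAd 0 Z = Z := by
  rw [expAd_apply, map_zero, expEnd_zero, Module.End.one_apply]

theorem expAd_map_apply (φ : g →ₗ⁅ℝ⁆ g) (X Z : g) : expAd (φ X) (φ Z) = φ (expAd X Z) :=
  (LinearMap.congr_fun (comp_expEnd_of_comp_eq (P := (φ : g →ₗ[ℝ] g))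
    (A := LieAlgebra.ad ℝ g X) (A' := LieAlgebra.ad ℝ g (φ X)) (by ext; simp)) Z).symm

theorem expAd_neg_expAd_apply (X Z : g) : expAd (-X) (expAd X Z) = Z := by
  rw [expAd_apply (-X), map_neg]
  exact (expAd X).left_inv Z

theorem expAd_apply_of_lie_eq_zero {X Z : g} (h : ⁅X, Z⁆ = 0) : expAd X Z = Z := by
  have := LinearMap.congr_fun (comp_expEnd_of_comp_eq (P := LinearMap.toSpanSingleton ℝ g Z)
    (A := 0) (A' := LieAlgebra.ad ℝ g X) (by ext; simp [h])) 1
  simpa [expAd_apply] using this.symm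

theorem expAd_apply_of_rotation {X Z Z' : g} (hZ : ⁅X, Z⁆ = -(Real.pi • Z'))
    (hZ' : ⁅X, Z'⁆ = Real.pi • Z) : expAd X Z = -Z := by
  have heigen : (LieAlgebra.ad ℝ g X).baseChange ℂ ((1 : ℂ) ⊗ₜ Z + Complex.I ⊗ₜ Z') =
      (Real.pi * Complex.I) • ((1 : ℂ) ⊗ₜ Z + Complex.I ⊗ₜ Z') := by
    simp [complexification_ext_iff, complexRe_smul, complexIm_smul, hZ, hZ']
  have hexp := baseChange_expEnd_apply_of_eigenvector heigen
  rw [Complex.exp_pi_mul_I, complexification_ext_iff, complexRe_baseChange] at hexp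
  simpa [expAd_apply] using hexp.1

theorem pow_four_eq_one_of_conj_eq_inv {M : Type*} [Group M] {i j : M}
    (hij : i * j * i⁻¹ = j⁻¹) (hji : j * i * j⁻¹ = i⁻¹) : i ^ 4 = 1 := by
  rw [mul_inv_eq_iff_eq_mul] at hij hji
  have hsq : i * i = j * j := by
    rw [eq_inv_mul_iff_mul_eq, ← mul_assoc] at hij hji
    calc i * i = i * (j * i * j) := by rw [hij]
      _ = i * j * i * j := by simp only [mul_assoc]
      _ = j * j := by rw [hji]
  calc i ^ 4 = i * (i * i) * i := by simp only [pow_succ, pow_zero, one_mul, mul_assoc]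
    _ = i * j * (j * i) := by rw [hsq]; simp only [mul_assoc]
    _ = 1 := by rw [hij, hji]; group

end InnerAutomorphisms

section RootSpaces

variable {g : Type*} [LieRing g] [LieAlgebra ℝ g] {B : LinearMap.BilinForm ℝ g}
  {a : Submodule ℝ g} {α β : g} {z w : ℂ ⊗[ℝ] g}

theorem mem_rootSpace_iff_baseChange : z ∈ rootSpace B a α ↔
    ∀ H ∈ a, (LieAlgebra.ad ℝ g H).baseChange ℂ z = (Complex.I * (B α H : ℂ)) • z := by
  have had (H : g) : LieAlgebra.ad ℂ (ℂ ⊗[ℝ] g) ((1 : ℂ) ⊗ₜ[ℝ] H) =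
      (LieAlgebra.ad ℝ g H).baseChange ℂ := LieModule.toEnd_baseChange ℝ ℂ g g H
  simp only [← had]
  rfl

theorem mem_rootSpace_iff : z ∈ rootSpace B a α ↔ ∀ H ∈ a,
    ⁅H, complexRe g z⁆ = -(B α H • complexIm g z) ∧
      ⁅H, complexIm g z⁆ = B α H • complexRe g z := by
  rw [mem_rootSpace_iff_baseChange]
  refine forall₂_congr fun H _ => ?_
  rw [complexification_ext_iff, complexRe_smul, complexIm_smul]
  simp

theorem lie_mem_rootSpace_add (hz : z ∈ rootSpace B a α) (hw : w ∈ rootSpace B a β) :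
    ⁅z, w⁆ ∈ rootSpace B a (α + β) := by
  intro H hH
  have hzH : ⁅(1 : ℂ) ⊗ₜ[ℝ] H, z⁆ = _ := hz H hH
  have hwH : ⁅(1 : ℂ) ⊗ₜ[ℝ] H, w⁆ = _ := hw H hH
  have hsmul_lie (c : ℂ) : ⁅c • z, w⁆ = c • ⁅z, w⁆ := smul_lie c z w
  have hlie_smul (c : ℂ) : ⁅z, c • w⁆ = c • ⁅z, w⁆ := lie_smul c z w
  rw [LieAlgebra.ad_apply, leibniz_lie, hzH, hwH, hsmul_lie, hlie_smul, ← add_smul, map_add,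
    LinearMap.add_apply]
  push_cast
  rw [mul_add]

theorem baseChange_mem_rootSpace (φ : g →ₗ⁅ℝ⁆ g)
    (hφ : ∀ H ∈ a, ∃ H' ∈ a, φ H' = H ∧ B α H' = B β H) (hz : z ∈ rootSpace B a α) :
    (φ : g →ₗ[ℝ] g).baseChange ℂ z ∈ rootSpace B a β := by
  rw [mem_rootSpace_iff_baseChange] at hz ⊢
  intro H hH
  obtain ⟨H', hH', rfl, hβ⟩ := hφ H hH
  have hcomp : LieAlgebra.ad ℝ g (φ H') ∘ₗ (φ : g →ₗ[ℝ] g) =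
      (φ : g →ₗ[ℝ] g) ∘ₗ LieAlgebra.ad ℝ g H' := by ext; simp
  rw [← LinearMap.comp_apply, ← LinearMap.baseChange_comp, hcomp, LinearMap.baseChange_comp,
    LinearMap.comp_apply, hz H' hH', map_smul, hβ]

theorem baseChange_expAd_of_mem_rootSpace [FiniteDimensional ℝ g] {H : g} (hH : H ∈ a)
    (hz : z ∈ rootSpace B a α) :
    (expAd H : g →ₗ[ℝ] g).baseChange ℂ z = Complex.exp (Complex.I * (B α H : ℂ)) • z :=
  baseChange_expEnd_apply_of_eigenvector (mem_rootSpace_iff_baseChange.1 hz H hH)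

theorem mem_minusPart_iff {t : g →ₗ[ℝ] g} {X : g} : X ∈ minusPart t ↔ t X = -X := by
  simp [minusPart]

theorem IsMaximalAbelian.mem_of_lie_eq_zero {p : Submodule ℝ g} (ha : IsMaximalAbelian p a)
    {X : g} (hX : X ∈ p) (hXa : ∀ H ∈ a, ⁅H, X⁆ = 0) : X ∈ a := by
  have hXa' (H : g) (hH : H ∈ a) : ⁅X, H⁆ = 0 := by rw [← lie_skew, hXa H hH, neg_zero]
  refine ha.2 (y := a ⊔ Submodule.span ℝ {X}) ⟨sup_le ha.1.1 ?_, ?_⟩ le_sup_left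
    (Submodule.mem_sup_right (Submodule.mem_span_singleton_self X))
  · rwa [Submodule.span_singleton_le_iff_mem]
  · intro Z hZ Z' hZ'
    simp only [Submodule.mem_sup, Submodule.mem_span_singleton] at hZ hZ'
    obtain ⟨H, hH, _, ⟨r, rfl⟩, rfl⟩ := hZ
    obtain ⟨H', hH', _, ⟨r', rfl⟩, rfl⟩ := hZ'
    simp [ha.1.2 H hH H' hH', hXa H hH, hXa' H' hH']

end RootSpaces

section Torus

variable {g : Type*} [LieRing g] [LieAlgebra ℝ g] {B : LinearMap.BilinForm ℝ g}
  {a : Submodule ℝ g}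

theorem commute_baseChange_ad {H H' : g} (h : ⁅H, H'⁆ = 0) :
    Commute ((LieAlgebra.ad ℝ g H).baseChange ℂ) ((LieAlgebra.ad ℝ g H').baseChange ℂ) := by
  rw [Commute, SemiconjBy, Module.End.mul_eq_comp, Module.End.mul_eq_comp,
    ← LinearMap.baseChange_comp, ← LinearMap.baseChange_comp]
  congr 1
  ext X
  simp [leibniz_lie H H', h]

theorem rootSpace_eq_bot_of_notMem {α : g} (hαa : α ∈ a) (hα0 : α ≠ 0)
    (hα : α ∉ restrictedRoots B a) : rootSpace B a α = ⊥ := by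
  by_contra hbot
  exact hα ⟨hαa, hα0, hbot⟩

variable [FiniteDimensional ℝ g]

namespace IsInvariantInnerProduct

theorem rootSpace_eq_iInf_maxGenEigenspace (hB : IsInvariantInnerProduct B) (α : g) :
    rootSpace B a α = ⨅ H : a, Module.End.maxGenEigenspace
      ((LieAlgebra.ad ℝ g (H : g)).baseChange ℂ) (Complex.I * (B α H : ℂ)) := by
  have hss (H : g) : Module.End.IsSemisimple ((LieAlgebra.ad ℝ g H).baseChange ℂ) :=
    isSemisimple_baseChange (hB.isInnerProduct.isSemisimple_of_skew (hB.invariant H))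
  ext z
  simp only [(hss _).isFinitelySemisimple.maxGenEigenspace_eq_eigenspace, Submodule.mem_iInf,
    Module.End.mem_eigenspace_iff, mem_rootSpace_iff_baseChange, Subtype.forall]

theorem exists_mem_forall_eigenvalue_eq (hB : IsInvariantInnerProduct B) {χ : a → ℂ}
    {z : ℂ ⊗[ℝ] g} (hz0 : z ≠ 0)
    (hz : ∀ H : a, (LieAlgebra.ad ℝ g (H : g)).baseChange ℂ z = χ H • z) :
    ∃ α ∈ a, ∀ H : a, χ H = Complex.I * (B α H : ℂ) := by
  obtain ⟨φ, hφ⟩ : ∃ φ : Module.Dual ℂ (ℂ ⊗[ℝ] g), φ z ≠ 0 := by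
    by_contra! hφ
    exact hz0 ((Module.forall_dual_apply_eq_zero_iff ℂ z).1 hφ)
  let χ' : a →ₗ[ℝ] ℂ := ((φ z)⁻¹ • φ).restrictScalars ℝ ∘ₗ
    (LinearMap.applyₗ z).restrictScalars ℝ ∘ₗ LinearMap.baseChangeHom ℝ ℂ g g ∘ₗ
    (LieAlgebra.ad ℝ g : g →ₗ[ℝ] Module.End ℝ g) ∘ₗ a.subtype
  have hχ' (H : a) : χ' H = χ H := by
    change (φ z)⁻¹ * φ ((LieAlgebra.ad ℝ g (H : g)).baseChange ℂ z) = χ H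
    rw [hz, map_smul, smul_eq_mul, mul_comm, mul_inv_cancel_right₀ hφ]
  obtain ⟨α, hα, hαχ⟩ := hB.isInnerProduct.exists_mem_forall_eq_apply (Complex.imLm ∘ₗ χ')
  refine ⟨α, hα, fun H => ?_⟩
  have hre := hB.isInnerProduct.re_eq_zero_of_skew (hB.invariant H) hz0 (hz H)
  have him : (χ H).im = B α H := by rw [← hαχ, ← hχ']; rfl
  apply Complex.ext <;> simp [hre, him]

variable (hB : IsInvariantInnerProduct B) (ha : ∀ X ∈ a, ∀ Y ∈ a, ⁅X, Y⁆ = 0)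
include hB ha

theorem finite_restrictedRoots : (restrictedRoots B a).Finite := by
  have hind := Module.End.independent_iInf_maxGenEigenspace_of_forall_mapsTo
    (fun H : a => (LieAlgebra.ad ℝ g (H : g)).baseChange ℂ) fun H H' =>
      Module.End.mapsTo_maxGenEigenspace_of_comm (commute_baseChange_ad (ha H' H'.2 H H.2))
  have hinj : Function.Injective fun (α H : a) => Complex.I * (B α H : ℂ) := fun α β hαβ => by
    refine Subtype.ext (hB.isInnerProduct.eq_of_forall_mem_apply_eq α.2 β.2 fun H hH => ?_)
    exact_mod_cast mul_left_cancel₀ Complex.I_ne_zero (congrFun hαβ ⟨H, hH⟩)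
  have hfin := WellFoundedGT.finite_ne_bot_of_iSupIndep (hind.comp hinj)
  refine (hfin.image Subtype.val).subset fun α hα => ⟨⟨α, hα.1⟩, ?_, rfl⟩
  have := hα.2.2
  rwa [hB.rootSpace_eq_iInf_maxGenEigenspace] at this

theorem iSup_rootSpace : ⨆ α : a, rootSpace B a (α : g) = ⊤ := by
  have hss (H : g) : Module.End.IsSemisimple ((LieAlgebra.ad ℝ g H).baseChange ℂ) :=
    isSemisimple_baseChange (hB.isInnerProduct.isSemisimple_of_skew (hB.invariant H))
  have htop := Module.End.iSup_iInf_maxGenEigenspace_eq_top_of_forall_mapsTo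
    (fun H : a => (LieAlgebra.ad ℝ g (H : g)).baseChange ℂ)
    (fun H H' => Module.End.mapsTo_maxGenEigenspace_of_comm
      (commute_baseChange_ad (ha H' H'.2 H H.2)))
    (fun H => Module.End.iSup_maxGenEigenspace_eq_top _)
  rw [eq_top_iff, ← htop]
  refine iSup_le fun χ z hz => ?_
  simp only [(hss _).isFinitelySemisimple.maxGenEigenspace_eq_eigenspace, Submodule.mem_iInf,
    Module.End.mem_eigenspace_iff] at hz
  rcases eq_or_ne z 0 with rfl | hz0
  · exact zero_mem _
  obtain ⟨α, hα, hχ⟩ := hB.exists_mem_forall_eigenvalue_eq hz0 hz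
  refine Submodule.mem_iSup_of_mem ⟨α, hα⟩ (mem_rootSpace_iff_baseChange.2 fun H hH => ?_)
  rw [hz ⟨H, hH⟩, hχ]

theorem eq_zero_of_forall_rootSpace {W : Type*} [AddCommGroup W] [Module ℂ W]
    {f : ℂ ⊗[ℝ] g →ₗ[ℂ] W} (hzero : ∀ z ∈ rootSpace B a 0, f z = 0)
    (hroot : ∀ α ∈ restrictedRoots B a, ∀ z ∈ rootSpace B a α, f z = 0) : f = 0 := by
  rw [← LinearMap.ker_eq_top, eq_top_iff, ← hB.iSup_rootSpace ha]
  refine iSup_le fun ⟨α, hα⟩ z hz => LinearMap.mem_ker.2 ?_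
  rcases eq_or_ne α 0 with rfl | hα0
  · exact hzero z hz
  by_cases hαr : α ∈ restrictedRoots B a
  · exact hroot α hαr z hz
  · rw [rootSpace_eq_bot_of_notMem hα hα0 hαr, Submodule.mem_bot] at hz
    rw [hz, map_zero]

theorem lie_eq_zero_of_forall_apply_eq_zero {H : g} (hH : H ∈ a)
    (horth : ∀ α ∈ restrictedRoots B a, B α H = 0) (Z : g) : ⁅H, Z⁆ = 0 := by
  have had : (LieAlgebra.ad ℝ g H).baseChange ℂ = 0 := by
    refine hB.eq_zero_of_forall_rootSpace ha (fun z hz => ?_) fun α hα z hz => ?_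
    · simp [mem_rootSpace_iff_baseChange.1 hz H hH]
    · simp [mem_rootSpace_iff_baseChange.1 hz H hH, horth α hα]
  have := complexRe_baseChange (LieAlgebra.ad ℝ g H) ((1 : ℂ) ⊗ₜ Z)
  simpa [had] using this.symm

theorem span_restrictedRoots (hcenter : LieAlgebra.center ℝ g = ⊥) :
    Submodule.span ℝ (restrictedRoots B a) = a := by
  have hle : Submodule.span ℝ (restrictedRoots B a) ≤ a := Submodule.span_le.2 fun α hα => hα.1
  refine le_antisymm hle fun X hX => ?_
  obtain ⟨Z, hZ, hXZ⟩ := hB.isInnerProduct.exists_mem_forall_eq_apply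
    ((B X).domRestrict (Submodule.span ℝ (restrictedRoots B a)))
  have horth (α : g) (hα : α ∈ restrictedRoots B a) : B α (X - Z) = 0 := by
    have := hXZ ⟨α, Submodule.subset_span hα⟩
    rw [LinearMap.domRestrict_apply] at this
    rw [hB.isInnerProduct.symm, map_sub, LinearMap.sub_apply, this, sub_self]
  have hmem : X - Z ∈ LieAlgebra.center ℝ g := fun Y => by
    rw [← lie_skew, neg_eq_zero]
    exact hB.lie_eq_zero_of_forall_apply_eq_zero ha (a.sub_mem hX (hle hZ)) horth Y
  rw [hcenter, LieSubmodule.mem_bot, sub_eq_zero] at hmem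
  rwa [hmem]

end IsInvariantInnerProduct

end Torus

section Irreducibility

theorem IsInnerProduct.add_notMem_union_of_orthogonal {V : Type*} [AddCommGroup V] [Module ℝ V]
    {B : LinearMap.BilinForm ℝ V} (hB : IsInnerProduct B) {Δ₁ Δ₂ : Set V}
    (horth : ∀ α ∈ Δ₁, ∀ β ∈ Δ₂, B α β = 0) {α β : V} (hα : α ∈ Δ₁) (hβ : β ∈ Δ₂)
    (hα0 : α ≠ 0) (hβ0 : β ≠ 0) : α + β ∉ Δ₁ ∪ Δ₂ := by
  rintro (hmem | hmem)
  · have := horth _ hmem β hβ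
    rw [map_add, LinearMap.add_apply, horth α hα β hβ, zero_add] at this
    exact hβ0 (hB.eq_zero_of_apply_self this)
  · have := horth α hα _ hmem
    rw [map_add, horth α hα β hβ, add_zero] at this
    exact hα0 (hB.eq_zero_of_apply_self this)

variable {g : Type*} [LieRing g] [LieAlgebra ℝ g] {B : LinearMap.BilinForm ℝ g}
  {a : Submodule ℝ g}

/-- The centralizer in `ℂ ⊗[ℝ] g` of the root spaces of all `β ∈ Δ`. -/
def rootCentralizer (B : LinearMap.BilinForm ℝ g) (a : Submodule ℝ g) (Δ : Set g) :
    Submodule ℂ (ℂ ⊗[ℝ] g) where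
  carrier := {ζ | ∀ β ∈ Δ, ∀ w ∈ rootSpace B a β, ⁅ζ, w⁆ = 0}
  add_mem' hζ hη β hβ w hw := by rw [add_lie, hζ β hβ w hw, hη β hβ w hw, add_zero]
  zero_mem' β _ w _ := zero_lie w
  smul_mem' c ζ hζ β hβ w hw := by
    have : ⁅c • ζ, w⁆ = c • ⁅ζ, w⁆ := smul_lie c ζ w
    rw [this, hζ β hβ w hw, smul_zero]

variable {Δ₁ Δ₂ : Set g}

theorem one_tmul_mem_rootCentralizer_iff {H : g} (hH : H ∈ a) {Δ : Set g}
    (hΔ : Δ ⊆ restrictedRoots B a) :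
    (1 : ℂ) ⊗ₜ H ∈ rootCentralizer B a Δ ↔ ∀ β ∈ Δ, B β H = 0 := by
  have hact {β : g} {w : ℂ ⊗[ℝ] g} (hw : w ∈ rootSpace B a β) :
      ⁅(1 : ℂ) ⊗ₜ[ℝ] H, w⁆ = (Complex.I * (B β H : ℂ)) • w := hw H hH
  refine forall₂_congr fun β hβ => ⟨fun h => ?_, fun h w hw => by simp [hact hw, h]⟩
  obtain ⟨w, hw, hw0⟩ := Submodule.exists_mem_ne_zero_of_ne_bot (hΔ hβ).2.2
  simpa [hact hw, hw0] using h w hw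

theorem rootSpace_le_rootCentralizer (hB : IsInnerProduct B)
    (hΔ : restrictedRoots B a = Δ₁ ∪ Δ₂) (horth : ∀ α ∈ Δ₁, ∀ β ∈ Δ₂, B α β = 0) {α : g}
    (hα : α ∈ Δ₁) : rootSpace B a α ≤ rootCentralizer B a Δ₂ := by
  intro z hz β hβ w hw
  obtain ⟨hαa, hα0, -⟩ : α ∈ restrictedRoots B a := hΔ ▸ .inl hα
  obtain ⟨hβa, hβ0, -⟩ : β ∈ restrictedRoots B a := hΔ ▸ .inr hβ
  have hadd := lie_mem_rootSpace_add hz hw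
  have hne : α + β ≠ 0 := fun h => by
    have := horth α hα β hβ
    rw [eq_neg_of_add_eq_zero_right h, map_neg, neg_eq_zero] at this
    exact hα0 (hB.eq_zero_of_apply_self this)
  rwa [rootSpace_eq_bot_of_notMem (a.add_mem hαa hβa) hne
    (hΔ ▸ hB.add_notMem_union_of_orthogonal horth hα hβ hα0 hβ0), Submodule.mem_bot] at hadd

variable [FiniteDimensional ℝ g]

theorem IsInvariantInnerProduct.lie_mem_rootCentralizer (hB : IsInvariantInnerProduct B)
    (ha : ∀ X ∈ a, ∀ Y ∈ a, ⁅X, Y⁆ = 0) (hΔ : restrictedRoots B a = Δ₁ ∪ Δ₂)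
    (horth : ∀ α ∈ Δ₁, ∀ β ∈ Δ₂, B α β = 0) (η : ℂ ⊗[ℝ] g) {ζ : ℂ ⊗[ℝ] g}
    (hζ : ζ ∈ rootCentralizer B a Δ₂) : ⁅η, ζ⁆ ∈ rootCentralizer B a Δ₂ := by
  intro β hβ w hw
  suffices hzero : LieAlgebra.ad ℂ (ℂ ⊗[ℝ] g) ζ ∘ₗ LieAlgebra.ad ℂ (ℂ ⊗[ℝ] g) w = 0 by
    have := LinearMap.congr_fun hzero η
    rw [LinearMap.comp_apply, LieAlgebra.ad_apply, LieAlgebra.ad_apply, leibniz_lie,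
      hζ β hβ w hw, zero_lie, zero_add, LinearMap.zero_apply] at this
    rw [← lie_skew, ← lie_skew η, lie_neg, neg_neg, this]
  refine hB.eq_zero_of_forall_rootSpace ha (fun z hz => ?_) fun γ hγ z hz => ?_
  · have := lie_mem_rootSpace_add hw hz
    rw [add_zero] at this
    exact hζ β hβ _ this
  · rw [LinearMap.comp_apply, LieAlgebra.ad_apply, LieAlgebra.ad_apply]
    rcases hΔ ▸ hγ with hγ | hγ
    · have hzw : ⁅z, w⁆ = 0 :=
        rootSpace_le_rootCentralizer hB.isInnerProduct hΔ horth hγ hz β hβ w hw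
      rw [← lie_skew w, lie_neg, hzw, lie_zero, neg_zero]
    · rw [leibniz_lie, hζ β hβ w hw, hζ γ hγ z hz, zero_lie, lie_zero, add_zero]

theorem IsInvariantInnerProduct.not_isReducible (hB : IsInvariantInnerProduct B)
    (ha : ∀ X ∈ a, ∀ Y ∈ a, ⁅X, Y⁆ = 0) [LieAlgebra.IsSimple ℝ g] :
    ¬ IsReducible B (restrictedRoots B a) := by
  rintro ⟨Δ₁, Δ₂, ⟨α₁, hα₁⟩, ⟨α₂, hα₂⟩, hΔ, -, horth⟩
  have hsub : Δ₂ ⊆ restrictedRoots B a := hΔ ▸ Set.subset_union_right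
  obtain ⟨hα₁a, hα₁0, -⟩ : α₁ ∈ restrictedRoots B a := hΔ ▸ .inl hα₁
  obtain ⟨hα₂a, hα₂0, -⟩ := hsub hα₂
  let J : LieIdeal ℝ g :=
    { ((rootCentralizer B a Δ₂).restrictScalars ℝ).comap (TensorProduct.mk ℝ ℂ g 1) with
      lie_mem := fun {X Z} hZ => by
        have := hB.lie_mem_rootCentralizer ha hΔ horth ((1 : ℂ) ⊗ₜ X) hZ
        simpa using this }
  have hJ {X : g} : X ∈ J ↔ (1 : ℂ) ⊗ₜ X ∈ rootCentralizer B a Δ₂ := Iff.rfl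
  have hα₁J : α₁ ∈ J := hJ.2 <| (one_tmul_mem_rootCentralizer_iff hα₁a hsub).2 fun β hβ => by
    rw [hB.isInnerProduct.symm, horth α₁ hα₁ β hβ]
  have hα₂J : α₂ ∉ J := fun h => hα₂0 <| hB.isInnerProduct.eq_zero_of_apply_self <|
    (one_tmul_mem_rootCentralizer_iff hα₂a hsub).1 (hJ.1 h) α₂ hα₂
  rcases LieAlgebra.IsSimple.eq_bot_or_eq_top J with hbot | htop
  · rw [hbot, LieSubmodule.mem_bot] at hα₁J
    exact hα₁0 hα₁J
  · exact hα₂J (htop ▸ LieSubmodule.mem_top α₂)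

end Irreducibility

section SymmetricPairs

variable {g : Type*} [LieRing g] [LieAlgebra ℝ g]

/-- An orthogonal symmetric Lie algebra `(g, t)` with invariant inner product `B`, together with a
maximal abelian subspace `a` of the `(-1)`-eigenspace of `t`. -/
structure IsSymmetricPair (B : LinearMap.BilinForm ℝ g) (t : g →ₗ⁅ℝ⁆ g) (a : Submodule ℝ g) :
    Prop where
  inner : IsInvariantInnerProduct B
  involutive : Function.Involutive t
  maximal : IsMaximalAbelian (minusPart (t : g →ₗ[ℝ] g)) a

variable {B : LinearMap.BilinForm ℝ g} {t : g →ₗ⁅ℝ⁆ g} {a : Submodule ℝ g} {α β : g}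

namespace IsSymmetricPair

section RootVectors

variable (h : IsSymmetricPair B t a)
include h

theorem isInnerProduct : IsInnerProduct B := h.inner.isInnerProduct

theorem map_eq_neg {H : g} (hH : H ∈ a) : t H = -H :=
  mem_minusPart_iff.1 (h.maximal.1.1 hH)

theorem lie_eq_zero {H H' : g} (hH : H ∈ a) (hH' : H' ∈ a) : ⁅H, H'⁆ = 0 :=
  h.maximal.1.2 H hH H' hH'

theorem apply_self_ne_zero (hα : α ∈ restrictedRoots B a) : B α α ≠ 0 :=
  (h.isInnerProduct.pos α hα.2.1).ne'

theorem ne_bot (ht : t ≠ LieHom.id) : a ≠ ⊥ := by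
  rintro rfl
  refine ht (LieHom.ext fun X => ?_)
  have hX : X - t X ∈ (⊥ : Submodule ℝ g) :=
    h.maximal.mem_of_lie_eq_zero (mem_minusPart_iff.2 (by simp [h.involutive X])) (by simp)
  exact (sub_eq_zero.1 ((Submodule.mem_bot ℝ).1 hX)).symm

-- The antilinear extension of `t` preserves each root space, so its fixed vectors span it.
theorem exists_mem_rootSpace_map_re_im (hα : rootSpace B a α ≠ ⊥) : ∃ z ∈ rootSpace B a α,
    z ≠ 0 ∧ t (complexRe g z) = complexRe g z ∧ t (complexIm g z) = -complexIm g z := by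
  let w (z : ℂ ⊗[ℝ] g) : ℂ ⊗[ℝ] g := 1 ⊗ₜ (complexRe g z + t (complexRe g z)) +
    Complex.I ⊗ₜ (complexIm g z - t (complexIm g z))
  have hw_mem {z : ℂ ⊗[ℝ] g} (hz : z ∈ rootSpace B a α) : w z ∈ rootSpace B a α := by
    rw [mem_rootSpace_iff] at hz ⊢
    intro H hH
    obtain ⟨hre, him⟩ := hz H hH
    have htre := congrArg t hre
    have htim := congrArg t him
    rw [LieHom.map_lie, h.map_eq_neg hH, neg_lie, map_neg, map_smul, neg_inj] at htre
    rw [LieHom.map_lie, h.map_eq_neg hH, neg_lie, map_smul, neg_eq_iff_eq_neg] at htim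
    constructor <;> simp [w, hre, him, htre, htim, sub_eq_add_neg, add_comm]
  have hw_fix (z : ℂ ⊗[ℝ] g) : t (complexRe g (w z)) = complexRe g (w z) ∧
      t (complexIm g (w z)) = -complexIm g (w z) := by
    simp [w, h.involutive (complexRe g z), h.involutive (complexIm g z), add_comm]
  suffices ∃ z ∈ rootSpace B a α, w z ≠ 0 from
    let ⟨z, hz, hwz⟩ := this
    ⟨w z, hw_mem hz, hwz, hw_fix z⟩
  by_contra! hw
  obtain ⟨z, hz, hz0⟩ := Submodule.exists_mem_ne_zero_of_ne_bot hα
  have hwz := complexification_ext_iff.1 (hw z hz)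
  have hwIz := complexification_ext_iff.1 (hw (Complex.I • z) (Submodule.smul_mem _ _ hz))
  simp only [w, map_add, complexRe_tmul, complexIm_tmul, complexRe_smul, complexIm_smul,
    Complex.one_re, Complex.one_im, Complex.I_re, Complex.I_im, one_smul, zero_smul, add_zero,
    zero_add, zero_sub, map_neg, map_zero] at hwz hwIz
  refine hz0 (complexification_ext_iff.2 ⟨?_, ?_⟩) <;> rw [map_zero]
  · linear_combination (norm := module) (1 / 2 : ℝ) • hwz.1 + (1 / 2 : ℝ) • hwIz.2
  · linear_combination (norm := module) (1 / 2 : ℝ) • hwz.2 - (1 / 2 : ℝ) • hwIz.1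

-- `α`, `S` and `T` span a copy of `𝔰𝔲(2)`.
theorem exists_rootVectors (hα : α ∈ restrictedRoots B a) : ∃ S T : g, T ≠ 0 ∧
    (∀ H ∈ a, ⁅H, S⁆ = -(B α H • T) ∧ ⁅H, T⁆ = B α H • S) ∧ ⁅S, T⁆ = -(B T T • α) := by
  obtain ⟨z, hz, hz0, hS, hT⟩ := h.exists_mem_rootSpace_map_re_im hα.2.2
  rw [mem_rootSpace_iff] at hz
  generalize hSz : complexRe g z = S at hz hS
  generalize hTz : complexIm g z = T at hz hT
  have hT0 : T ≠ 0 := by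
    rintro rfl
    have hS0 := (hz α hα.1).2
    rw [lie_zero, eq_comm, smul_eq_zero_iff_right (h.apply_self_ne_zero hα)] at hS0
    exact hz0 (complexification_ext_iff.2 (by simp [hSz, hTz, hS0]))
  have hmem : ⁅S, T⁆ ∈ a := by
    refine h.maximal.mem_of_lie_eq_zero (mem_minusPart_iff.2 ?_) fun H hH => ?_
    · rw [LieHom.coe_toLinearMap, LieHom.map_lie, hS, hT, lie_neg]
    · simp [leibniz_lie, hz H hH]
  refine ⟨S, T, hT0, hz, h.isInnerProduct.eq_of_forall_mem_apply_eq hmem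
    (a.neg_mem (a.smul_mem _ hα.1)) fun H hH => ?_⟩
  have hinv := h.inner.invariant S T H
  rw [← lie_skew S H, (hz H hH).1, neg_neg, map_smul, smul_eq_mul] at hinv
  rw [hinv, map_neg, map_smul, LinearMap.neg_apply, LinearMap.smul_apply, smul_eq_mul, mul_comm]

end RootVectors

section WeylGroup

variable [FiniteDimensional ℝ g] (h : IsSymmetricPair B t a)
include h

theorem exists_expAd_eq_reflection (hα : α ∈ restrictedRoots B a) : ∃ X : g,
    (∀ H ∈ a, expAd X H = reflection B α H) ∧ expAd ((Real.pi / B α α) • α) X = -X := by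
  obtain ⟨S, T, hT0, hH, hST⟩ := h.exists_rootVectors hα
  have hαα := h.isInnerProduct.pos α hα.2.1
  have hTT := h.isInnerProduct.pos T hT0
  have hpi := Real.pi_pos
  obtain ⟨s, hs⟩ : ∃ s : ℝ, s ^ 2 * B α α * B T T = Real.pi ^ 2 :=
    ⟨Real.pi / √(B α α * B T T), by
      rw [div_pow, Real.sq_sqrt (by positivity)]
      field_simp⟩
  refine ⟨s • S, fun H hHa => ?_, ?_⟩
  · have hneg : expAd (s • S) α = -α := by
      refine expAd_apply_of_rotation (Z' := -((s * B α α / Real.pi) • T)) ?_ ?_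
      · rw [smul_lie, ← lie_skew, (hH α hα.1).1, neg_neg, smul_neg, neg_neg, smul_smul, smul_smul,
          mul_div_cancel₀ _ hpi.ne']
      · rw [smul_lie, lie_neg, lie_smul, hST, smul_neg, smul_neg, smul_neg, neg_neg,
          smul_smul, smul_smul]
        congr 1
        field_simp
        linear_combination hs
    have hfix : expAd (s • S) (H - (B α H / B α α) • α) = H - (B α H / B α α) • α := by
      refine expAd_apply_of_lie_eq_zero ?_
      rw [smul_lie, ← lie_skew, (hH _ (a.sub_mem hHa (a.smul_mem _ hα.1))).1]
      simp [hαα.ne']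
    rw [map_sub, map_smul, hneg, sub_eq_iff_eq_add] at hfix
    rw [hfix, reflection]
    module
  · rw [map_smul, expAd_apply_of_rotation (Z' := T), smul_neg]
    · rw [smul_lie, (hH α hα.1).1, smul_neg, smul_smul, div_mul_cancel₀ _ hαα.ne']
    · rw [smul_lie, (hH α hα.1).2, smul_smul, div_mul_cancel₀ _ hαα.ne']

theorem finrank_rootSpace_reflection (hα : α ∈ restrictedRoots B a) (β : g) :
    Module.finrank ℂ (rootSpace B a (reflection B α β)) =
      Module.finrank ℂ (rootSpace B a β) := by
  obtain ⟨X, hX, -⟩ := h.exists_expAd_eq_reflection hα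
  have hrefl := reflection_reflection (h.apply_self_ne_zero hα)
  have hmem (γ : g) (z : ℂ ⊗[ℝ] g) (hz : z ∈ rootSpace B a γ) :
      (expAd X : g →ₗ[ℝ] g).baseChange ℂ z ∈ rootSpace B a (reflection B α γ) := by
    refine baseChange_mem_rootSpace (expAd X).toLieHom (fun H hH =>
      have hH' := reflection_mem_of_mem (B := B) hα.1 hH
      ⟨reflection B α H, hH', ?_, ?_⟩) hz
    · exact (hX _ hH').trans (hrefl H)
    · rw [h.isInnerProduct.apply_reflection_left]
  have hle (γ : g) : Module.finrank ℂ (rootSpace B a γ) ≤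
      Module.finrank ℂ (rootSpace B a (reflection B α γ)) :=
    LinearMap.finrank_le_finrank_of_injective
      (f := ((expAd X : g →ₗ[ℝ] g).baseChange ℂ).restrict (hmem γ)) fun z w hzw =>
        Subtype.ext (((expAd X).toLinearEquiv.baseChange ℝ ℂ g g).injective
          (congrArg Subtype.val hzw))
  exact le_antisymm ((hle _).trans_eq (by rw [hrefl])) (hle β)

theorem isRootMultiplicity :
    IsRootMultiplicity B (restrictedRoots B a) (restrictedMult B a) where
  pos α hα := by
    rw [restrictedMult, Nat.cast_pos, Nat.pos_iff_ne_zero, Ne, Submodule.finrank_eq_zero]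
    exact hα.2.2
  reflection_eq α hα β _ := congrArg Nat.cast (h.finrank_rootSpace_reflection hα β)

theorem reflection_mem (hα : α ∈ restrictedRoots B a) (hβ : β ∈ restrictedRoots B a) :
    reflection B α β ∈ restrictedRoots B a := by
  refine ⟨reflection_mem_of_mem hα.1 hβ.1, fun h0 => hβ.2.1 ?_, ?_⟩
  · rw [← reflection_reflection (h.apply_self_ne_zero hα) β, h0]
    simp [reflection]
  · rw [← Submodule.one_le_finrank_iff, h.finrank_rootSpace_reflection hα,
      Submodule.one_le_finrank_iff]
    exact hβ.2.2

-- `exp (ad X)` and `exp (ad Z)` invert each other under conjugation, as `i` and `j` do in the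
-- quaternion group.
theorem expAd_root_pow_four (hα : α ∈ restrictedRoots B a) :
    (expAd ((Real.pi / B α α) • α)).toLinearEquiv ^ 4 = 1 := by
  obtain ⟨X, hX, hXα⟩ := h.exists_expAd_eq_reflection hα
  set Z := (Real.pi / B α α) • α with hZ
  have hZX : expAd X Z = -Z := by
    rw [hX Z (a.smul_mem _ hα.1), hZ, reflection_smul_self (h.apply_self_ne_zero hα)]
  have hconj {U W : g} (hUW : expAd U W = -W) : (expAd U).toLinearEquiv *
      (expAd W).toLinearEquiv * (expAd U).toLinearEquiv⁻¹ = (expAd W).toLinearEquiv⁻¹ := by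
    rw [mul_inv_eq_iff_eq_mul, eq_inv_mul_iff_mul_eq]
    ext V
    have hmap : expAd (expAd U W) (expAd U V) = expAd U (expAd W V) :=
      expAd_map_apply (expAd U).toLieHom W V
    rw [hUW] at hmap
    have hinv := expAd_neg_expAd_apply (-W) (expAd U V)
    rwa [neg_neg, hmap] at hinv
  exact pow_four_eq_one_of_conj_eq_inv (hconj hXα) (hconj hZX)

theorem integral (hα : α ∈ restrictedRoots B a) (hβ : β ∈ restrictedRoots B a) :
    ∃ k : ℤ, 2 * B α β / B α α = k := by
  set Z := (Real.pi / B α α) • α with hZ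
  obtain ⟨z, hz, hz0⟩ := Submodule.exists_mem_ne_zero_of_ne_bot hβ.2.2
  have hexp : Complex.exp (Complex.I * (B β Z : ℂ)) ^ 4 = 1 := by
    have hD : (expAd Z : g →ₗ[ℝ] g) ^ 4 = 1 :=
      congrArg LinearEquiv.toLinearMap (h.expAd_root_pow_four hα)
    have heig : Module.End.HasEigenvector ((expAd Z : g →ₗ[ℝ] g).baseChange ℂ)
        (Complex.exp (Complex.I * (B β Z : ℂ))) z :=
      ⟨Module.End.mem_eigenspace_iff.2
        (baseChange_expAd_of_mem_rootSpace (a.smul_mem _ hα.1) hz), hz0⟩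
    have hpow := heig.pow_apply 4
    rw [← LinearMap.baseChange_pow, hD, LinearMap.baseChange_one, Module.End.one_apply] at hpow
    exact smul_left_injective ℂ hz0 (hpow.symm.trans (one_smul ℂ z).symm)
  rw [← Complex.exp_nat_mul, Complex.exp_eq_one_iff] at hexp
  obtain ⟨k, hk⟩ := hexp
  have hZk : 2 * B β Z = Real.pi * k := Complex.ofReal_injective <| by
    push_cast at hk ⊢
    linear_combination -(Complex.I / 2) * hk + (2 * B β Z - k * Real.pi : ℂ) * Complex.I_sq
  rw [hZ, map_smul, smul_eq_mul, h.isInnerProduct.symm β α] at hZk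
  exact ⟨k, mul_left_cancel₀ Real.pi_ne_zero (by rw [← hZk]; ring)⟩

theorem isIrreducibleRootSystem [LieAlgebra.IsSimple ℝ g] (ht : t ≠ LieHom.id) :
    IsIrreducibleRootSystem B a (restrictedRoots B a) where
  isRootSystem :=
    { finite := h.inner.finite_restrictedRoots h.maximal.1.2
      zero_notMem := fun h0 => h0.2.1 rfl
      span_eq := h.inner.span_restrictedRoots h.maximal.1.2 (LieAlgebra.center_eq_bot ℝ g)
      reflection_mem := fun _ hα _ hβ => h.reflection_mem hα hβ
      integral := fun _ hα _ hβ => h.integral hα hβ }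
  nonempty := by
    rw [Set.nonempty_iff_ne_empty]
    intro hempty
    refine h.ne_bot ht ?_
    rw [← h.inner.span_restrictedRoots h.maximal.1.2 (LieAlgebra.center_eq_bot ℝ g), hempty,
      Submodule.span_empty]
  not_reducible := h.inner.not_isReducible h.maximal.1.2

end WeylGroup

end IsSymmetricPair

end SymmetricPairs

section TypeIV

variable {g : Type*} [LieRing g] [LieAlgebra ℝ g] {B : LinearMap.BilinForm ℝ g}
  {a : Submodule ℝ g} {α : g}

theorem rootSpaceEps_eq_rootSpace {t : g →ₗ[ℝ] g} {c : ℂ}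
    (ht : ∀ z ∈ rootSpace B a α, t.baseChange ℂ z = c • z) :
    rootSpaceEps B a t α c = rootSpace B a α :=
  inf_eq_left.2 fun z hz => Module.End.mem_eigenspace_iff.2 (ht z hz)

theorem rootSpaceEps_eq_bot {t : g →ₗ[ℝ] g} {c ε : ℂ}
    (ht : ∀ z ∈ rootSpace B a α, t.baseChange ℂ z = c • z) (hc : c ≠ ε) :
    rootSpaceEps B a t α ε = ⊥ := by
  refine (Submodule.eq_bot_iff _).2 fun z hz => ?_
  have hzε : c • z = ε • z := by rw [← ht z hz.1, Module.End.mem_eigenspace_iff.1 hz.2]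
  rw [← sub_eq_zero, ← sub_smul] at hzε
  exact (smul_eq_zero.1 hzε).resolve_left (sub_ne_zero.2 hc)

theorem notMem_sigmaAt_of_mem_wAt {V : Type*} [AddCommGroup V] [Module ℝ V]
    {B : LinearMap.BilinForm ℝ V} {Δ : Set V} {Y l : V} (hl : l ∈ wAt B Δ Y) :
    l ∉ sigmaAt B Δ Y := by
  rintro ⟨-, k, hk⟩
  obtain ⟨-, k', hk'⟩ := hl
  have hodd : (1 + 2 * k' : ℝ) = 2 * k :=
    mul_left_cancel₀ Real.pi_ne_zero (by linear_combination hk - hk')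
  norm_cast at hodd
  omega

namespace IsSymmetricPair

variable [FiniteDimensional ℝ g] {t₁ t₂ : g →ₗ⁅ℝ⁆ g} {Y : g} (h : IsSymmetricPair B t₁ a)
  (hY : Y ∈ a) (hconj : ∀ X, t₂ (expAd Y X) = expAd Y (t₁ X))
include h hY hconj

theorem map_eq_neg_of_conj {H : g} (hH : H ∈ a) : t₂ H = -H := by
  have hfix : expAd Y H = H := expAd_apply_of_lie_eq_zero (h.lie_eq_zero hY hH)
  have hmap := hconj H
  rwa [hfix, h.map_eq_neg hH, map_neg, hfix] at hmap

theorem isMaximalAbelian_inf :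
    IsMaximalAbelian (minusPart (t₁ : g →ₗ[ℝ] g) ⊓ minusPart (t₂ : g →ₗ[ℝ] g)) a :=
  ⟨⟨le_inf h.maximal.1.1 fun _ hH => mem_minusPart_iff.2 (h.map_eq_neg_of_conj hY hconj hH),
    h.maximal.1.2⟩, fun _ hb hab => h.maximal.2 ⟨hb.1.trans inf_le_left, hb.2⟩ hab⟩

-- `t₁ t₂ exp (ad Y) = t₁ exp (ad Y) t₁ = exp (ad (t₁ Y)) = exp (-ad Y)`.
theorem baseChange_comp_of_mem_rootSpace {z : ℂ ⊗[ℝ] g} (hz : z ∈ rootSpace B a α) :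
    ((t₁ : g →ₗ[ℝ] g) ∘ₗ (t₂ : g →ₗ[ℝ] g)).baseChange ℂ z =
      Complex.exp (-(Complex.I * (B α ((2 : ℝ) • Y) : ℂ))) • z := by
  have hcomp : ((t₁ : g →ₗ[ℝ] g) ∘ₗ (t₂ : g →ₗ[ℝ] g)) ∘ₗ (expAd Y : g →ₗ[ℝ] g) =
      (expAd (-Y) : g →ₗ[ℝ] g) := by
    ext X
    change t₁ (t₂ (expAd Y X)) = expAd (-Y) X
    rw [hconj, ← expAd_map_apply, h.map_eq_neg hY, h.involutive]
  have hz' := congrArg (fun f => f.baseChange ℂ z) hcomp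
  simp only [LinearMap.baseChange_comp, LinearMap.comp_apply] at hz'
  rw [baseChange_expAd_of_mem_rootSpace hY hz, map_smul, map_smul,
    baseChange_expAd_of_mem_rootSpace (a.neg_mem hY) hz] at hz'
  have hexp : Complex.exp (Complex.I * (B α Y : ℂ)) *
      Complex.exp (-(Complex.I * (B α ((2 : ℝ) • Y) : ℂ))) =
        Complex.exp (Complex.I * (B α (-Y) : ℂ)) := by
    rw [← Complex.exp_add, map_smul, map_neg, smul_eq_mul]
    push_cast
    ring_nf
  rw [LinearMap.baseChange_comp, LinearMap.comp_apply]
  refine smul_right_injective _ (Complex.exp_ne_zero (Complex.I * (B α Y : ℂ))) ?_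
  simp only [smul_smul]
  rw [hz', hexp]

theorem exists_apply_two_smul_eq (hcomm : ∀ X, t₁ (t₂ X) = t₂ (t₁ X))
    (hα : α ∈ restrictedRoots B a) : ∃ k : ℤ, B α ((2 : ℝ) • Y) = Real.pi * k := by
  have ht₂ (X : g) : t₂ (t₂ X) = X := by
    obtain ⟨X, rfl⟩ := (expAd Y).surjective X
    change t₂ (t₂ (expAd Y X)) = expAd Y X
    rw [hconj, hconj, h.involutive]
  have hsq : ((t₁ : g →ₗ[ℝ] g) ∘ₗ (t₂ : g →ₗ[ℝ] g)) ^ 2 = 1 := by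
    ext X
    change t₁ (t₂ (t₁ (t₂ X))) = X
    rw [← hcomm, h.involutive, ht₂]
  obtain ⟨z, hz, hz0⟩ := Submodule.exists_mem_ne_zero_of_ne_bot hα.2.2
  have heig : Module.End.HasEigenvector _ _ z := ⟨Module.End.mem_eigenspace_iff.2
    (h.baseChange_comp_of_mem_rootSpace hY hconj hz), hz0⟩
  have hpow := heig.pow_apply 2
  rw [← LinearMap.baseChange_pow, hsq, LinearMap.baseChange_one, Module.End.one_apply] at hpow
  have hexp := smul_left_injective ℂ hz0 (hpow.symm.trans (one_smul ℂ z).symm)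
  rw [← Complex.exp_nat_mul, Complex.exp_eq_one_iff] at hexp
  obtain ⟨k, hk⟩ := hexp
  refine ⟨-k, Complex.ofReal_injective ?_⟩
  push_cast at hk ⊢
  linear_combination (Complex.I / 2) * hk + (B α ((2 : ℝ) • Y) + k * Real.pi : ℂ) * Complex.I_sq

theorem mem_latticeΓ (hcomm : ∀ X, t₁ (t₂ X) = t₂ (t₁ X)) :
    Y ∈ latticeΓ B a (restrictedRoots B a) := by
  refine ⟨hY, fun α hα => ?_⟩
  obtain ⟨k, hk⟩ := h.exists_apply_two_smul_eq hY hconj hcomm hα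
  refine ⟨k, ?_⟩
  rw [map_smul, smul_eq_mul] at hk
  linear_combination hk / 2

theorem rootSpaceEps_of_mem_sigmaAt {Δ : Set g} (hα : α ∈ sigmaAt B Δ Y) :
    rootSpaceEps B a ((t₁ : g →ₗ[ℝ] g) ∘ₗ (t₂ : g →ₗ[ℝ] g)) α 1 = rootSpace B a α ∧
      rootSpaceEps B a ((t₁ : g →ₗ[ℝ] g) ∘ₗ (t₂ : g →ₗ[ℝ] g)) α (-1) = ⊥ := by
  have heig := fun z (hz : z ∈ rootSpace B a α) =>
    h.baseChange_comp_of_mem_rootSpace hY hconj hz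
  obtain ⟨-, k, hk⟩ := hα
  have hexp : Complex.exp (-(Complex.I * (B α ((2 : ℝ) • Y) : ℂ))) = 1 :=
    Complex.exp_eq_one_iff.2 ⟨-k, by rw [hk]; push_cast; ring⟩
  rw [hexp] at heig
  exact ⟨rootSpaceEps_eq_rootSpace heig, rootSpaceEps_eq_bot heig (by norm_num)⟩

theorem rootSpaceEps_of_mem_wAt {Δ : Set g} (hα : α ∈ wAt B Δ Y) :
    rootSpaceEps B a ((t₁ : g →ₗ[ℝ] g) ∘ₗ (t₂ : g →ₗ[ℝ] g)) α 1 = ⊥ ∧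
      rootSpaceEps B a ((t₁ : g →ₗ[ℝ] g) ∘ₗ (t₂ : g →ₗ[ℝ] g)) α (-1) = rootSpace B a α := by
  have heig := fun z (hz : z ∈ rootSpace B a α) =>
    h.baseChange_comp_of_mem_rootSpace hY hconj hz
  obtain ⟨-, k, hk⟩ := hα
  have hexp : Complex.exp (-(Complex.I * (B α ((2 : ℝ) • Y) : ℂ))) = -1 := by
    rw [← Complex.exp_pi_mul_I, Complex.exp_eq_exp_iff_exists_int]
    exact ⟨-k - 1, by rw [hk]; push_cast; ring⟩
  rw [hexp] at heig
  exact ⟨rootSpaceEps_eq_bot heig (by norm_num), rootSpaceEps_eq_rootSpace heig⟩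

theorem mem_sigmaAt_or_mem_wAt (hcomm : ∀ X, t₁ (t₂ X) = t₂ (t₁ X))
    (hα : α ∈ restrictedRoots B a) :
    α ∈ sigmaAt B (restrictedRoots B a) Y ∨ α ∈ wAt B (restrictedRoots B a) Y := by
  obtain ⟨k, hk⟩ := h.exists_apply_two_smul_eq hY hconj hcomm hα
  obtain ⟨l, rfl | rfl⟩ := k.even_or_odd'
  · exact .inl ⟨hα, l, by rw [hk]; push_cast; ring⟩
  · exact .inr ⟨hα, l, by rw [hk]; push_cast; ring⟩

theorem sigma_triadOf_eq (hcomm : ∀ X, t₁ (t₂ X) = t₂ (t₁ X)) :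
    (triadOf B a (t₁ : g →ₗ[ℝ] g) (t₂ : g →ₗ[ℝ] g)).sigma =
      sigmaAt B (restrictedRoots B a) Y := by
  ext α
  refine ⟨fun ⟨hαa, hα0, hα, hε⟩ => ?_, fun hα => ⟨hα.1.1, hα.1.2.1, hα.1.2.2, ?_⟩⟩
  · exact (h.mem_sigmaAt_or_mem_wAt hY hconj hcomm ⟨hαa, hα0, hα⟩).resolve_right
      fun hw => hε (h.rootSpaceEps_of_mem_wAt hY hconj hw).1
  · rw [(h.rootSpaceEps_of_mem_sigmaAt hY hconj hα).1]
    exact hα.1.2.2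

theorem w_triadOf_eq (hcomm : ∀ X, t₁ (t₂ X) = t₂ (t₁ X)) :
    (triadOf B a (t₁ : g →ₗ[ℝ] g) (t₂ : g →ₗ[ℝ] g)).w = wAt B (restrictedRoots B a) Y := by
  ext α
  refine ⟨fun ⟨hαa, hα0, hα, hε⟩ => ?_, fun hα => ⟨hα.1.1, hα.1.2.1, hα.1.2.2, ?_⟩⟩
  · exact (h.mem_sigmaAt_or_mem_wAt hY hconj hcomm ⟨hαa, hα0, hα⟩).resolve_left
      fun hs => hε (h.rootSpaceEps_of_mem_sigmaAt hY hconj hs).2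
  · rw [(h.rootSpaceEps_of_mem_wAt hY hconj hα).2]
    exact hα.1.2.2

theorem isTypeIVWith [LieAlgebra.IsSimple ℝ g] (ht₁ : t₁ ≠ LieHom.id)
    (hcomm : ∀ X, t₁ (t₂ X) = t₂ (t₁ X)) :
    IsTypeIVWith B a (triadOf B a (t₁ : g →ₗ[ℝ] g) (t₂ : g →ₗ[ℝ] g)) (restrictedRoots B a)
      (restrictedMult B a) Y := by
  have hsigma := h.sigma_triadOf_eq hY hconj hcomm
  have hw := h.w_triadOf_eq hY hconj hcomm
  have hsigma_eps := fun α hα =>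
    h.rootSpaceEps_of_mem_sigmaAt hY hconj (α := α) (hsigma.le hα)
  have hw_eps := fun α hα => h.rootSpaceEps_of_mem_wAt hY hconj (α := α) (hw.le hα)
  have hdim {U U' : Submodule ℂ (ℂ ⊗[ℝ] g)} (hU : U = U') :
      (Module.finrank ℂ U : ℝ) = Module.finrank ℂ U' := by rw [hU]
  refine ⟨h.isIrreducibleRootSystem ht₁, h.isRootMultiplicity, h.mem_latticeΓ hY hconj hcomm, rfl,
    hsigma, hw, ?_, ?_, ?_, ?_, ?_⟩
  · rw [hw]
    exact Set.Subset.antisymm (fun α hα => ⟨hα.1, notMem_sigmaAt_of_mem_wAt hα⟩)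
      fun α hα => (h.mem_sigmaAt_or_mem_wAt hY hconj hcomm hα.1).resolve_left hα.2
  · exact fun α hα => hdim (hsigma_eps α hα).1
  · exact fun α hα => (hdim (hsigma_eps α hα).2).trans (by simp)
  · exact fun α hα => (hdim (hw_eps α hα).1).trans (by simp)
  · exact fun α hα => hdim (hw_eps α hα).2

end IsSymmetricPair

end TypeIV

section VanishingDerivative

variable {E : Type*} [NormedAddCommGroup E] [NormedSpace ℝ E]
  {M : Type*} [TopologicalSpace M] [ChartedSpace E M] [IsManifold 𝓘(ℝ, E) 1 M]
  {E' : Type*} [NormedAddCommGroup E'] [NormedSpace ℝ E']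
  {N : Type*} [TopologicalSpace N] [ChartedSpace E' N] [IsManifold 𝓘(ℝ, E') 1 N]

theorem hasFDerivAt_writtenInExtChartAt_zero {f : M → N} {x : M} {z : E}
    (hz : z ∈ (extChartAt 𝓘(ℝ, E) x).target)
    (hfz : f ((extChartAt 𝓘(ℝ, E) x).symm z) ∈ (extChartAt 𝓘(ℝ, E') (f x)).source)
    (hf : HasMFDerivAt 𝓘(ℝ, E) 𝓘(ℝ, E') f ((extChartAt 𝓘(ℝ, E) x).symm z) 0) :
    HasFDerivAt (writtenInExtChartAt 𝓘(ℝ, E) 𝓘(ℝ, E') x f) (0 : E →L[ℝ] E') z := by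
  have hφ : MDifferentiableAt 𝓘(ℝ, E) 𝓘(ℝ, E) (extChartAt 𝓘(ℝ, E) x).symm z := by
    have := mdifferentiableWithinAt_extChartAt_symm (I := 𝓘(ℝ, E)) hz
    rwa [modelWithCornersSelf_coe, Set.range_id, mdifferentiableWithinAt_univ] at this
  have hψ : MDifferentiableAt 𝓘(ℝ, E') 𝓘(ℝ, E') (extChartAt 𝓘(ℝ, E') (f x))
      (f ((extChartAt 𝓘(ℝ, E) x).symm z)) :=
    mdifferentiableAt_extChartAt (by rwa [← extChartAt_source 𝓘(ℝ, E')])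
  have hcomp := (hψ.hasMFDerivAt.comp _ hf).comp z hφ.hasMFDerivAt
  rw [ContinuousLinearMap.comp_zero, ContinuousLinearMap.zero_comp] at hcomp
  exact hcomp.hasFDerivAt

theorem isLocallyConstant_of_hasMFDerivAt_zero {f : M → N}
    (hf : ∀ x, HasMFDerivAt 𝓘(ℝ, E) 𝓘(ℝ, E') f x 0) : IsLocallyConstant f := by
  rw [IsLocallyConstant.iff_eventually_eq]
  intro x
  set φ := extChartAt 𝓘(ℝ, E) x
  set ψ := extChartAt 𝓘(ℝ, E') (f x)
  set F := writtenInExtChartAt 𝓘(ℝ, E) 𝓘(ℝ, E') x f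
  have hcont : Continuous f := continuous_iff_continuousAt.2 fun x => (hf x).continuousAt
  set s : Set E := φ.target ∩ φ.symm ⁻¹' (f ⁻¹' ψ.source)
  have hs : IsOpen s := (continuousOn_extChartAt_symm x).isOpen_inter_preimage
    (isOpen_extChartAt_target x) ((isOpen_extChartAt_source (f x)).preimage hcont)
  have hF : ∀ z ∈ s, HasFDerivAt F (0 : E →L[ℝ] E') z := fun z hz =>
    hasFDerivAt_writtenInExtChartAt_zero hz.1 hz.2 (hf _)
  have hopen : IsOpen (s ∩ F ⁻¹' {ψ (f x)}) := hs.isOpen_inter_preimage_of_fderiv_eq_zero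
    (fun z hz => (hF z hz).differentiableAt.differentiableWithinAt) (fun z hz => (hF z hz).fderiv) _
  have hx : φ x ∈ s ∩ F ⁻¹' {ψ (f x)} := by
    simp [s, F, φ, ψ, writtenInExtChartAt]
  filter_upwards [(continuousAt_extChartAt (I := 𝓘(ℝ, E)) x).preimage_mem_nhds (hopen.mem_nhds hx),
    extChartAt_source_mem_nhds (I := 𝓘(ℝ, E)) x] with y ⟨hys, hyF⟩ hy
  have hsource : f (φ.symm (φ y)) ∈ ψ.source := hys.2
  have heq : ψ (f (φ.symm (φ y))) = ψ (f x) := hyF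
  rw [φ.left_inv hy] at hsource heq
  exact ψ.injOn hsource (mem_extChartAt_source (f x)) heq

end VanishingDerivative

section Homomorphisms

variable {E : Type*} [NormedAddCommGroup E] [NormedSpace ℝ E]
  {G : Type*} [TopologicalSpace G] [ChartedSpace E G] [Group G] [LieGroup 𝓘(ℝ, E) ∞ G]
  {E' : Type*} [NormedAddCommGroup E'] [NormedSpace ℝ E']
  {H : Type*} [TopologicalSpace H] [ChartedSpace E' H]

theorem hasMFDerivAt_mul_inv_zero {f₁ f₂ : H → G} {x : H} {f' : E' →L[ℝ] E}
    (hf₁ : HasMFDerivAt 𝓘(ℝ, E') 𝓘(ℝ, E) f₁ x f') (hf₂ : HasMFDerivAt 𝓘(ℝ, E') 𝓘(ℝ, E) f₂ x f')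
    (hx : f₁ x = f₂ x) :
    HasMFDerivAt 𝓘(ℝ, E') 𝓘(ℝ, E) (fun z => f₁ z * (f₂ z)⁻¹) x 0 := by
  let P : G × G → G := fun p => p.1 * p.2⁻¹
  have hP : MDifferentiable (𝓘(ℝ, E).prod 𝓘(ℝ, E)) 𝓘(ℝ, E) P :=
    (contMDiff_fst.mul contMDiff_snd.inv : ContMDiff _ _ ∞ P).mdifferentiable (by simp)
  have hP₂ := (hP (f₂ x, f₂ x)).hasMFDerivAt
  have hP₁ : HasMFDerivAt (𝓘(ℝ, E).prod 𝓘(ℝ, E)) 𝓘(ℝ, E) P (f₁ x, f₂ x)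
      (mfderiv (𝓘(ℝ, E).prod 𝓘(ℝ, E)) 𝓘(ℝ, E) P (f₂ x, f₂ x) : E × E →L[ℝ] E) := by
    rwa [hx]
  have hdiag := HasMFDerivAt.comp (f := fun z => (f₂ z, f₂ z)) (g := P) x hP₂ (hf₂.prodMk hf₂)
  have hconst : HasMFDerivAt 𝓘(ℝ, E') 𝓘(ℝ, E) (P ∘ fun z => (f₂ z, f₂ z)) x
      (0 : E' →L[ℝ] E) := by
    have : (P ∘ fun z => (f₂ z, f₂ z)) = fun _ => 1 := funext fun z => mul_inv_cancel (f₂ z)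
    rw [this]
    exact hasMFDerivAt_const 1 x
  have hpair := HasMFDerivAt.comp (f := fun z => (f₁ z, f₂ z)) (g := P) x hP₁ (hf₁.prodMk hf₂)
  exact hasMFDerivAt_unique hdiag hconst ▸ hpair

variable [Group H] [LieGroup 𝓘(ℝ, E') ∞ H]

theorem monoidHom_eq_of_mfderiv_one_eq [PreconnectedSpace H] {φ ψ : H →* G}
    (hφ : MDifferentiableAt 𝓘(ℝ, E') 𝓘(ℝ, E) φ 1) (hψ : MDifferentiableAt 𝓘(ℝ, E') 𝓘(ℝ, E) ψ 1)
    (h : (mfderiv 𝓘(ℝ, E') 𝓘(ℝ, E) φ 1 : E' →L[ℝ] E) = mfderiv 𝓘(ℝ, E') 𝓘(ℝ, E) ψ 1) :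
    φ = ψ := by
  have : IsManifold 𝓘(ℝ, E) 1 G := IsManifold.of_le (n := ∞) (by simp)
  have : IsManifold 𝓘(ℝ, E') 1 H := IsManifold.of_le (n := ∞) (by simp)
  have hone : HasMFDerivAt 𝓘(ℝ, E') 𝓘(ℝ, E) (fun z => φ z * (ψ z)⁻¹) 1 0 :=
    hasMFDerivAt_mul_inv_zero (h ▸ hφ.hasMFDerivAt) hψ.hasMFDerivAt (by simp only [map_one])
  have hall (x : H) : HasMFDerivAt 𝓘(ℝ, E') 𝓘(ℝ, E) (fun z => φ z * (ψ z)⁻¹) x 0 := by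
    have hin := ((contMDiff_mul_left (I := 𝓘(ℝ, E')) (n := ∞) (a := x⁻¹)).mdifferentiableAt
      (by simp) (x := x)).hasMFDerivAt
    have hout : ContMDiff 𝓘(ℝ, E) 𝓘(ℝ, E) ∞ (fun w : G => φ x * w * (ψ x)⁻¹) :=
      contMDiff_mul_right.comp contMDiff_mul_left
    rw [← inv_mul_cancel x] at hone
    have hcomp := (hout.mdifferentiableAt (by simp)).hasMFDerivAt.comp x (hone.comp x hin)
    rw [ContinuousLinearMap.zero_comp, ContinuousLinearMap.comp_zero] at hcomp
    refine hcomp.congr_of_eventuallyEq (Filter.Eventually.of_forall fun z => ?_)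
    simp [mul_assoc]
  ext x
  have := (isLocallyConstant_of_hasMFDerivAt_zero hall).apply_eq_of_preconnectedSpace x 1
  rwa [map_one, map_one, inv_one, mul_one, mul_inv_eq_one] at this

end Homomorphisms

section Differential

variable {E : Type*} [NormedAddCommGroup E] [NormedSpace ℝ E]
  {G : Type*} [TopologicalSpace G] [ChartedSpace E G] [Group G] {t t' : MulAut G}

theorem differential_one : differential E (1 : MulAut G) = LinearMap.id := by
  ext v
  exact congrArg (fun L : E →L[ℝ] E => L v) (mfderiv_id (I := 𝓘(ℝ, E)) (x := (1 : G)))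

theorem differential_mul_apply (ht : ContMDiff 𝓘(ℝ, E) 𝓘(ℝ, E) ∞ t)
    (ht' : ContMDiff 𝓘(ℝ, E) 𝓘(ℝ, E) ∞ t') (v : GroupLieAlgebra 𝓘(ℝ, E) G) :
    differential E (t * t') v = differential E t (differential E t' v) :=
  mfderiv_comp_apply_of_eq (x := 1) (f := fun x : G => t' x) (g := fun x : G => t x)
    (ht.mdifferentiableAt (by simp)) (ht'.mdifferentiableAt (by simp)) (map_one t') v

theorem isInvertible_mfderiv_mulAut (ht : ContMDiff 𝓘(ℝ, E) 𝓘(ℝ, E) ∞ t)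
    (hti : ContMDiff 𝓘(ℝ, E) 𝓘(ℝ, E) ∞ ⇑(t⁻¹)) (x : G) :
    (mfderiv 𝓘(ℝ, E) 𝓘(ℝ, E) t x).IsInvertible :=
  let Φ : G ≃ₘ^∞⟮𝓘(ℝ, E), 𝓘(ℝ, E)⟯ G :=
    { toEquiv := t.toEquiv, contMDiff_toFun := ht, contMDiff_invFun := hti }
  ⟨Φ.mfderivToContinuousLinearEquiv (x := x) (by simp), rfl⟩

variable [LieGroup 𝓘(ℝ, E) ∞ G]

theorem eq_one_of_differential_eq_id [PreconnectedSpace G]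
    (ht : ContMDiff 𝓘(ℝ, E) 𝓘(ℝ, E) ∞ t) (hd : differential E t = LinearMap.id) : t = 1 := by
  have h : t.toMonoidHom = MonoidHom.id G :=
    monoidHom_eq_of_mfderiv_one_eq (ht.mdifferentiableAt (by simp)) mdifferentiableAt_id <|
      ContinuousLinearMap.ext fun v =>
        LinearMap.congr_fun (hd.trans (differential_one (E := E)).symm) v
  exact MulEquiv.ext fun x => DFunLike.congr_fun h x

theorem mulInvariantVectorField_differential (ht : ContMDiff 𝓘(ℝ, E) 𝓘(ℝ, E) ∞ t)
    (v : GroupLieAlgebra 𝓘(ℝ, E) G) (x : G) :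
    mulInvariantVectorField (differential E t v) (t x) =
      mfderiv 𝓘(ℝ, E) 𝓘(ℝ, E) t x (mulInvariantVectorField v x) := by
  have hmul (y : G) : MDifferentiableAt 𝓘(ℝ, E) 𝓘(ℝ, E) (fun z => y * z) 1 :=
    contMDiff_mul_left.mdifferentiableAt (n := ∞) (by simp)
  have hmd (y : G) : MDifferentiableAt 𝓘(ℝ, E) 𝓘(ℝ, E) (fun z : G => t z) y :=
    ht.mdifferentiableAt (by simp)
  have hleft := mfderiv_comp_apply_of_eq (x := 1) (hmd x) (hmul x) (mul_one x) v
  have hright := mfderiv_comp_apply_of_eq (x := 1) (hmul (t x)) (hmd 1) (map_one t) v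
  have hcomp : (fun z : G => t z) ∘ (fun z => x * z) = (fun z => t x * z) ∘ (fun z => t z) :=
    funext fun z => map_mul t x z
  rw [hcomp] at hleft
  exact hright.symm.trans hleft

theorem mpullback_mulInvariantVectorField_differential (ht : ContMDiff 𝓘(ℝ, E) 𝓘(ℝ, E) ∞ t)
    (hti : ContMDiff 𝓘(ℝ, E) 𝓘(ℝ, E) ∞ ⇑(t⁻¹)) (v : GroupLieAlgebra 𝓘(ℝ, E) G) :
    VectorField.mpullback 𝓘(ℝ, E) 𝓘(ℝ, E) t (mulInvariantVectorField (differential E t v)) =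
      mulInvariantVectorField v := by
  ext x
  rw [VectorField.mpullback_apply, mulInvariantVectorField_differential ht]
  exact (isInvertible_mfderiv_mulAut ht hti x).inverse_apply_eq.2 rfl

theorem differential_lie [CompleteSpace E] (ht : ContMDiff 𝓘(ℝ, E) 𝓘(ℝ, E) ∞ t)
    (hti : ContMDiff 𝓘(ℝ, E) 𝓘(ℝ, E) ∞ ⇑(t⁻¹)) (v w : GroupLieAlgebra 𝓘(ℝ, E) G) :
    differential E t ⁅v, w⁆ = ⁅differential E t v, differential E t w⁆ := by
  have hbracket := VectorField.mpullback_mlieBracket (n := ∞) (f := t) (x₀ := 1)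
    (mdifferentiableAt_mulInvariantVectorField (differential E t v) (g := t 1))
    (mdifferentiableAt_mulInvariantVectorField (differential E t w) (g := t 1))
    ht.contMDiffAt (by rw [minSmoothness_of_isRCLikeNormedField]; exact ENat.LEInfty.out)
  rw [mpullback_mulInvariantVectorField_differential ht hti,
    mpullback_mulInvariantVectorField_differential ht hti, VectorField.mpullback_apply,
    (isInvertible_mfderiv_mulAut ht hti 1).inverse_apply_eq] at hbracket
  have htransport (x : G) (hx : x = 1) (V W : (x : G) → TangentSpace 𝓘(ℝ, E) x) :
      (VectorField.mlieBracket 𝓘(ℝ, E) V W x : E) = VectorField.mlieBracket 𝓘(ℝ, E) V W 1 := by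
    rw [hx]
  exact hbracket.symm.trans (htransport (t 1) (map_one t) _ _)

variable (E) in
/-- The differential of a smooth automorphism with smooth inverse, as an endomorphism of the Lie
algebra. -/
noncomputable def differentialLieHom [CompleteSpace E] (t : MulAut G)
    (ht : ContMDiff 𝓘(ℝ, E) 𝓘(ℝ, E) ∞ t) (hti : ContMDiff 𝓘(ℝ, E) 𝓘(ℝ, E) ∞ ⇑(t⁻¹)) :
    GroupLieAlgebra 𝓘(ℝ, E) G →ₗ⁅ℝ⁆ GroupLieAlgebra 𝓘(ℝ, E) G where
  toLinearMap := differential E t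
  map_lie' := differential_lie ht hti _ _

end Differential

section ChartAtIdentity

variable {E : Type*} [NormedAddCommGroup E] [NormedSpace ℝ E]
  {G : Type*} [TopologicalSpace G] [ChartedSpace E G]

theorem hasMFDerivAt_extChartAt_self [IsManifold 𝓘(ℝ, E) 1 G] (x : G) :
    HasMFDerivAt 𝓘(ℝ, E) 𝓘(ℝ, E) (extChartAt 𝓘(ℝ, E) x) x (ContinuousLinearMap.id ℝ E) :=
  (mdifferentiableAt_extChartAt (mem_chart_source E x)).hasMFDerivAt.congr_mfderiv
    mfderiv_extChartAt_self

theorem hasMFDerivAt_extChartAt_symm_self [IsManifold 𝓘(ℝ, E) 1 G] (x : G) :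
    HasMFDerivAt 𝓘(ℝ, E) 𝓘(ℝ, E) (extChartAt 𝓘(ℝ, E) x).symm (extChartAt 𝓘(ℝ, E) x x)
      (ContinuousLinearMap.id ℝ E : E →L[ℝ] E) := by
  have hdiff := mdifferentiableWithinAt_extChartAt_symm (I := 𝓘(ℝ, E)) (mem_extChartAt_target x)
  have hderiv := mfderivWithin_range_extChartAt_symm (I := 𝓘(ℝ, E)) (x := x)
  rw [modelWithCornersSelf_coe, Set.range_id] at hdiff hderiv
  rw [mfderivWithin_univ] at hderiv
  exact (mdifferentiableWithinAt_univ.1 hdiff).hasMFDerivAt.congr_mfderiv hderiv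

theorem hasFDerivAt_comp_extChartAt_symm [IsManifold 𝓘(ℝ, E) 1 G] {x : G} {f : G → E}
    {f' : E →L[ℝ] E} (hf : HasMFDerivAt 𝓘(ℝ, E) 𝓘(ℝ, E) f x f') :
    HasFDerivAt (f ∘ (extChartAt 𝓘(ℝ, E) x).symm) f' (extChartAt 𝓘(ℝ, E) x x) := by
  rw [← extChartAt_to_inv (I := 𝓘(ℝ, E)) x] at hf
  exact (hf.comp _ (hasMFDerivAt_extChartAt_symm_self x)).hasFDerivAt

variable [Group G]

variable (E G) in
/-- The preferred chart of `G` at the identity, in which the group law is differentiated. -/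
noncomputable abbrev chartOne : PartialEquiv G E := extChartAt 𝓘(ℝ, E) (1 : G)

variable (E G) in
/-- The multiplication of `G` read in the chart at the identity; it is meaningful only near
`(chartOne E G 1, chartOne E G 1)`. -/
noncomputable def chartMul (p : E × E) : E :=
  chartOne E G ((chartOne E G).symm p.1 * (chartOne E G).symm p.2)

variable (E G) in
/-- The mixed second derivative `∂₁∂₂` at the identity of the multiplication read in a chart. Its
antisymmetrization is the Lie bracket of `G`. -/
noncomputable def chartMulMixed : E →L[ℝ] E →L[ℝ] E :=
  (fderiv ℝ (fderiv ℝ (chartMul E G)) (chartOne E G 1, chartOne E G 1)).bilinearComp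
    (ContinuousLinearMap.inl ℝ E E) (ContinuousLinearMap.inr ℝ E E)

theorem chartMul_one_left :
    ∀ᶠ x in nhds (chartOne E G 1), chartMul E G (chartOne E G 1, x) = x := by
  filter_upwards [extChartAt_target_mem_nhds (I := 𝓘(ℝ, E)) (1 : G)] with x hx
  rw [chartMul, extChartAt_to_inv, one_mul, (chartOne E G).right_inv hx]

theorem chartMul_one_right :
    ∀ᶠ x in nhds (chartOne E G 1), chartMul E G (x, chartOne E G 1) = x := by
  filter_upwards [extChartAt_target_mem_nhds (I := 𝓘(ℝ, E)) (1 : G)] with x hx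
  rw [chartMul, extChartAt_to_inv, mul_one, (chartOne E G).right_inv hx]

theorem hasFDerivAt_chartMul_left {x y : E} (h : DifferentiableAt ℝ (chartMul E G) (x, y)) :
    HasFDerivAt (fun x => chartMul E G (x, y))
      ((fderiv ℝ (chartMul E G) (x, y)).comp (ContinuousLinearMap.inl ℝ E E)) x :=
  HasFDerivAt.comp (g := chartMul E G) (f := fun x => (x, y)) x h.hasFDerivAt
    (hasFDerivAt_prodMk_left x y)

theorem hasFDerivAt_chartMul_right {x y : E} (h : DifferentiableAt ℝ (chartMul E G) (x, y)) :
    HasFDerivAt (fun y => chartMul E G (x, y))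
      ((fderiv ℝ (chartMul E G) (x, y)).comp (ContinuousLinearMap.inr ℝ E E)) y :=
  HasFDerivAt.comp (g := chartMul E G) (f := fun y => (x, y)) y h.hasFDerivAt
    (hasFDerivAt_prodMk_right x y)

variable [LieGroup 𝓘(ℝ, E) ∞ G]

theorem contDiffAt_chartMul :
    ContDiffAt ℝ 2 (chartMul E G) (chartOne E G 1, chartOne E G 1) := by
  have hsymm : ContMDiffAt 𝓘(ℝ, E) 𝓘(ℝ, E) ∞ (chartOne E G).symm (chartOne E G 1) :=
    (contMDiffOn_extChartAt_symm 1).contMDiffAt (extChartAt_target_mem_nhds 1)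
  have hmul : ContMDiffAt 𝓘(ℝ, E × E) 𝓘(ℝ, E) ∞
      (fun p : E × E => (chartOne E G).symm p.1 * (chartOne E G).symm p.2)
      (chartOne E G 1, chartOne E G 1) :=
    (hsymm.comp (chartOne E G 1, chartOne E G 1) contDiff_fst.contMDiff.contMDiffAt).mul
      (hsymm.comp (chartOne E G 1, chartOne E G 1) contDiff_snd.contMDiff.contMDiffAt)
  have hchart : ContMDiffAt 𝓘(ℝ, E) 𝓘(ℝ, E) ∞ (chartOne E G)
      ((chartOne E G).symm (chartOne E G 1) * (chartOne E G).symm (chartOne E G 1)) := by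
    rw [extChartAt_to_inv, mul_one]
    exact contMDiffAt_extChartAt
  have hcomp := hchart.comp (chartOne E G 1, chartOne E G 1) hmul
  exact (contMDiffAt_iff_contDiffAt.1 hcomp).of_le ENat.LEInfty.out

theorem differentiableAt_chartMul_one :
    DifferentiableAt ℝ (chartMul E G) (chartOne E G 1, chartOne E G 1) :=
  contDiffAt_chartMul.differentiableAt (by simp)

theorem eventually_differentiableAt_chartMul {α : Type*} {l : Filter α} {u v : α → E}
    (hu : Filter.Tendsto u l (nhds (chartOne E G 1)))
    (hv : Filter.Tendsto v l (nhds (chartOne E G 1))) :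
    ∀ᶠ s in l, DifferentiableAt ℝ (chartMul E G) (u s, v s) :=
  (hu.prodMk_nhds hv).eventually <|
    (contDiffAt_chartMul.eventually (by simp)).mono fun _ hp => hp.differentiableAt (by simp)

theorem fderiv_chartMul_one_inl :
    (fderiv ℝ (chartMul E G) (chartOne E G 1, chartOne E G 1)).comp
      (ContinuousLinearMap.inl ℝ E E) = ContinuousLinearMap.id ℝ E :=
  (hasFDerivAt_chartMul_left differentiableAt_chartMul_one).unique
    ((hasFDerivAt_id _).congr_of_eventuallyEq chartMul_one_right)

theorem fderiv_chartMul_one_inr :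
    (fderiv ℝ (chartMul E G) (chartOne E G 1, chartOne E G 1)).comp
      (ContinuousLinearMap.inr ℝ E E) = ContinuousLinearMap.id ℝ E :=
  (hasFDerivAt_chartMul_right differentiableAt_chartMul_one).unique
    ((hasFDerivAt_id _).congr_of_eventuallyEq chartMul_one_left)

theorem hasFDerivAt_fderiv_chartMul :
    HasFDerivAt (fderiv ℝ (chartMul E G))
      (fderiv ℝ (fderiv ℝ (chartMul E G)) (chartOne E G 1, chartOne E G 1))
      (chartOne E G 1, chartOne E G 1) :=
  ((contDiffAt_chartMul.fderiv_right (m := 1) (by norm_num)).differentiableAt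
    (by simp)).hasFDerivAt

theorem hasFDerivAt_fderiv_chartMul_inl :
    HasFDerivAt (fun x => (fderiv ℝ (chartMul E G) (chartOne E G 1, x)).comp
      (ContinuousLinearMap.inl ℝ E E)) (chartMulMixed E G).flip (chartOne E G 1) := by
  have hsymm : IsSymmSndFDerivAt ℝ (chartMul E G) (chartOne E G 1, chartOne E G 1) :=
    contDiffAt_chartMul.isSymmSndFDerivAt (by rw [minSmoothness_of_isRCLikeNormedField])
  have hcomp := (HasFDerivAt.comp (f := fun x : E => (chartOne E G 1, x)) (chartOne E G 1)
    hasFDerivAt_fderiv_chartMul (hasFDerivAt_prodMk_right _ _)).clm_comp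
    (hasFDerivAt_const (ContinuousLinearMap.inl ℝ E E) (chartOne E G 1))
  refine hcomp.congr_fderiv (ContinuousLinearMap.ext fun v => ContinuousLinearMap.ext fun w => ?_)
  simpa [chartMulMixed] using hsymm (0, v) (w, 0)

theorem hasFDerivAt_fderiv_chartMul_inr :
    HasFDerivAt (fun x => (fderiv ℝ (chartMul E G) (x, chartOne E G 1)).comp
      (ContinuousLinearMap.inr ℝ E E)) (chartMulMixed E G) (chartOne E G 1) := by
  have hcomp := (HasFDerivAt.comp (f := fun x : E => (x, chartOne E G 1)) (chartOne E G 1)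
    hasFDerivAt_fderiv_chartMul (hasFDerivAt_prodMk_left _ _)).clm_comp
    (hasFDerivAt_const (ContinuousLinearMap.inr ℝ E E) (chartOne E G 1))
  refine hcomp.congr_fderiv (ContinuousLinearMap.ext fun v => ContinuousLinearMap.ext fun w => ?_)
  simp [chartMulMixed]

/-- The left-invariant vector field of `w` read in the chart at the identity. -/
noncomputable def chartField (w : GroupLieAlgebra 𝓘(ℝ, E) G) : E → E :=
  VectorField.mpullback 𝓘(ℝ, E) 𝓘(ℝ, E) (chartOne E G).symm (mulInvariantVectorField w)

theorem chartField_eq {x : E} (hx : x ∈ (chartOne E G).target)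
    (h : DifferentiableAt ℝ (chartMul E G) (x, chartOne E G 1)) (w : GroupLieAlgebra 𝓘(ℝ, E) G) :
    chartField w x = (fderiv ℝ (chartMul E G) (x, chartOne E G 1)).comp
      (ContinuousLinearMap.inr ℝ E E) w := by
  have : IsManifold 𝓘(ℝ, E) 1 G := IsManifold.of_le (n := ∞) (by simp)
  set k := (chartOne E G).symm x
  have hk : k ∈ (chartAt E (1 : G)).source := by
    rw [← extChartAt_source 𝓘(ℝ, E)]
    exact (chartOne E G).map_target hx
  have hmul := (contMDiff_mul_left (I := 𝓘(ℝ, E)) (n := ∞) (a := k)).mdifferentiableAt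
    (by simp) (x := 1) |>.hasMFDerivAt
  have hchart : HasMFDerivAt 𝓘(ℝ, E) 𝓘(ℝ, E) (chartOne E G) (k * 1)
      (mfderiv 𝓘(ℝ, E) 𝓘(ℝ, E) (chartOne E G) k : E →L[ℝ] E) := by
    rw [mul_one]
    exact (mdifferentiableAt_extChartAt hk).hasMFDerivAt
  have hderiv : (fderiv ℝ (chartMul E G) (x, chartOne E G 1)).comp
      (ContinuousLinearMap.inr ℝ E E) w = (mfderiv 𝓘(ℝ, E) 𝓘(ℝ, E) (chartOne E G) k : E →L[ℝ] E)
        (mulInvariantVectorField w k : E) :=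
    DFunLike.congr_fun ((hasFDerivAt_chartMul_right h).unique
      (hasFDerivAt_comp_extChartAt_symm (hchart.comp 1 hmul))) w
  have hinv := isInvertible_mfderivWithin_extChartAt_symm (I := 𝓘(ℝ, E)) hx
  have hcomp := mfderivWithin_extChartAt_symm_comp_mfderiv_extChartAt (I := 𝓘(ℝ, E)) hx
  rw [modelWithCornersSelf_coe, Set.range_id, mfderivWithin_univ] at hinv hcomp
  rw [hderiv]
  exact hinv.inverse_apply_eq.2 (DFunLike.congr_fun hcomp (mulInvariantVectorField w k)).symm

theorem chartField_one (w : GroupLieAlgebra 𝓘(ℝ, E) G) :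
    chartField w (chartOne E G 1) = w := by
  rw [chartField_eq (mem_extChartAt_target 1) differentiableAt_chartMul_one,
    fderiv_chartMul_one_inr]
  rfl

theorem hasFDerivAt_chartField (w : GroupLieAlgebra 𝓘(ℝ, E) G) :
    HasFDerivAt (chartField w) ((chartMulMixed E G).flip w) (chartOne E G 1) := by
  have hright := (ContinuousLinearMap.apply (E := E) ℝ E w).hasFDerivAt.comp (chartOne E G 1)
    (hasFDerivAt_fderiv_chartMul_inr (G := G))
  refine hright.congr_of_eventuallyEq ?_
  filter_upwards [extChartAt_target_mem_nhds (I := 𝓘(ℝ, E)) (1 : G),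
    eventually_differentiableAt_chartMul Filter.tendsto_id tendsto_const_nhds] with x hx hx'
  exact chartField_eq hx hx' w

theorem lie_eq_lieBracket_chartField (v w : GroupLieAlgebra 𝓘(ℝ, E) G) :
    ⁅v, w⁆ = VectorField.lieBracket ℝ (chartField v) (chartField w) (chartOne E G 1) := by
  have : IsManifold 𝓘(ℝ, E) 1 G := IsManifold.of_le (n := ∞) (by simp)
  have hchart : (mfderiv 𝓘(ℝ, E) 𝓘(ℝ, E) (chartOne E G) 1 : E →L[ℝ] E) =
      ContinuousLinearMap.id ℝ E := mfderiv_extChartAt_self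
  have hbracket : ⁅v, w⁆ = (ContinuousLinearMap.inverse
      (mfderiv 𝓘(ℝ, E) 𝓘(ℝ, E) (chartOne E G) 1 : E →L[ℝ] E) : E →L[ℝ] E)
      (VectorField.lieBracketWithin (E := E) ℝ
        (VectorField.mpullbackWithin 𝓘(ℝ, E) 𝓘(ℝ, E) (chartOne E G).symm
          (mulInvariantVectorField v) (Set.range 𝓘(ℝ, E)))
        (VectorField.mpullbackWithin 𝓘(ℝ, E) 𝓘(ℝ, E) (chartOne E G).symm
          (mulInvariantVectorField w) (Set.range 𝓘(ℝ, E)))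
        ((chartOne E G).symm ⁻¹' Set.univ ∩ Set.range 𝓘(ℝ, E)) (chartOne E G 1)) := by
    rw [GroupLieAlgebra.bracket_def, ← VectorField.mlieBracketWithin_univ,
      VectorField.mlieBracketWithin_apply]
    rfl
  rw [hchart, ContinuousLinearMap.inverse_id, modelWithCornersSelf_coe, Set.range_id,
    Set.preimage_univ, Set.univ_inter, VectorField.mpullbackWithin_univ,
    VectorField.mpullbackWithin_univ] at hbracket
  rw [← VectorField.lieBracketWithin_univ]
  exact hbracket

theorem lie_eq_chartMulMixed_sub (v w : GroupLieAlgebra 𝓘(ℝ, E) G) :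
    ⁅v, w⁆ = chartMulMixed E G v w - chartMulMixed E G w v := by
  rw [lie_eq_lieBracket_chartField, VectorField.lieBracket, chartField_one, chartField_one,
    (hasFDerivAt_chartField v).fderiv, (hasFDerivAt_chartField w).fderiv]
  rfl

end ChartAtIdentity

section BanachAlgebra

variable {R : Type*} [NormedRing R] [NormedAlgebra ℝ R] [CompleteSpace R]

theorem hasFDerivAt_of_mul_eq {E : Type*} [NormedAddCommGroup E] [NormedSpace ℝ E]
    {P F Q : E → R} {p q : E →L[ℝ] R} {x : E} (hP : HasFDerivAt P p x) (hQ : HasFDerivAt Q q x)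
    (hPx : P x = 1) (hQx : Q x = 1) (hmul : ∀ᶠ z in nhds x, P z * F z = Q z) :
    HasFDerivAt F (q - p) x := by
  have hunit : ∀ᶠ z in nhds x, IsUnit (P z) :=
    hP.continuousAt.preimage_mem_nhds (Units.isOpen.mem_nhds (hPx ▸ isUnit_one))
  have hinverse : HasFDerivAt Ring.inverse (-ContinuousLinearMap.mulLeftRight ℝ R 1 1) (P x) := by
    simpa [hPx] using hasFDerivAt_ringInverse (𝕜 := ℝ) (1 : Rˣ)
  have hprod := (hinverse.comp x hP).mul' hQ
  refine (hprod.congr_fderiv ?_).congr_of_eventuallyEq ?_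
  · ext v
    simp [hPx, hQx, sub_eq_add_neg]
  · filter_upwards [hmul, hunit] with z hz hu
    exact (Ring.inverse_mul_cancel_left _ (F z) hu ▸ congrArg (Ring.inverse (P z) * ·) hz)

theorem eq_exp_smul_of_map_add {F : ℝ → R} {A : R} (hF : HasDerivAt F A 0) (hzero : F 0 = 1)
    (hadd : ∀ s t, F (s + t) = F s * F t) (s : ℝ) : F s = NormedSpace.exp (s • A) := by
  let : NormedAlgebra ℚ R := NormedAlgebra.restrictScalars ℚ ℝ R
  have hderiv (s : ℝ) : HasDerivAt F (F s * A) s := by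
    have hshift := (HasDerivAt.comp_sub_const (f := F) s s (by rwa [sub_self])).const_mul (F s)
    exact hshift.congr_of_eventuallyEq (Filter.Eventually.of_forall fun r => by
      simp only [← hadd, add_sub_cancel])
  have hconst (s : ℝ) :
      HasDerivAt (fun s => F s * NormedSpace.exp (s • -A)) 0 s := by
    refine ((hderiv s).mul (hasDerivAt_exp_smul_const' (-A) s)).congr_deriv ?_
    noncomm_ring
  have hone : F s * NormedSpace.exp (s • -A) = 1 := by
    simpa [hzero] using is_const_of_deriv_eq_zero (fun r => (hconst r).differentiableAt)
      (fun r => (hconst r).deriv) s 0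
  rw [smul_neg] at hone
  calc F s = F s * (NormedSpace.exp (-(s • A)) * NormedSpace.exp (s • A)) := by
        rw [← NormedSpace.exp_add_of_commute (Commute.refl (s • A)).neg_left, neg_add_cancel,
          NormedSpace.exp_zero, mul_one]
    _ = NormedSpace.exp (s • A) := by rw [← mul_assoc, hone, one_mul]

end BanachAlgebra

section Adjoint

variable {E : Type*} [NormedAddCommGroup E] [NormedSpace ℝ E]
  {G : Type*} [TopologicalSpace G] [ChartedSpace E G] [Group G]

variable (E) in
/-- The adjoint action of `y : G` on the tangent space at the identity, as a continuous linear map;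
the underlying linear map is `differential E (MulAut.conj y)`. -/
noncomputable def adjointCLM (y : G) : E →L[ℝ] E :=
  mfderiv 𝓘(ℝ, E) 𝓘(ℝ, E) (fun x : G => MulAut.conj y x) 1

theorem adjointCLM_one : adjointCLM E (1 : G) = 1 := by
  ext v
  have h := differential_one (E := E) (G := G)
  rw [← map_one MulAut.conj] at h
  exact LinearMap.congr_fun h v

variable [LieGroup 𝓘(ℝ, E) ∞ G]

theorem contMDiff_conj (y : G) : ContMDiff 𝓘(ℝ, E) 𝓘(ℝ, E) ∞ (MulAut.conj y) :=
  (contMDiff_mul_right (a := y⁻¹)).comp (contMDiff_mul_left (a := y))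

theorem adjointCLM_mul (x y : G) :
    adjointCLM E (x * y) = adjointCLM E x * adjointCLM E y := by
  ext v
  have h := differential_mul_apply (contMDiff_conj (E := E) x) (contMDiff_conj y) v
  rwa [← map_mul] at h

theorem hasFDerivAt_conj_chartOne (y : G) :
    HasFDerivAt (fun x => chartOne E G (MulAut.conj y ((chartOne E G).symm x))) (adjointCLM E y)
      (chartOne E G 1) := by
  have : IsManifold 𝓘(ℝ, E) 1 G := IsManifold.of_le (n := ∞) (by simp)
  have hchart := hasMFDerivAt_extChartAt_self (E := E) (1 : G)
  nth_rw 2 [← map_one (MulAut.conj y)] at hchart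
  have hconj := ((contMDiff_conj (E := E) y).mdifferentiableAt (by simp) (x := 1)).hasMFDerivAt
  exact hasFDerivAt_comp_extChartAt_symm
    (HasMFDerivAt.comp (f := fun x : G => MulAut.conj y x) 1 hchart hconj)

theorem chartMul_comp_adjointCLM {y : G} (hy : y ∈ (chartOne E G).source)
    (hl : DifferentiableAt ℝ (chartMul E G) (chartOne E G 1, chartOne E G y))
    (hr : DifferentiableAt ℝ (chartMul E G) (chartOne E G y, chartOne E G 1)) :
    ((fderiv ℝ (chartMul E G) (chartOne E G 1, chartOne E G y)).comp
      (ContinuousLinearMap.inl ℝ E E)).comp (adjointCLM E y) =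
    (fderiv ℝ (chartMul E G) (chartOne E G y, chartOne E G 1)).comp
      (ContinuousLinearMap.inr ℝ E E) := by
  set k : E → G := fun x => MulAut.conj y ((chartOne E G).symm x)
  have hk : k (chartOne E G 1) = 1 := by simp only [k, extChartAt_to_inv, map_one]
  have hleft : HasFDerivAt (fun x => chartMul E G (x, chartOne E G y))
      ((fderiv ℝ (chartMul E G) (chartOne E G 1, chartOne E G y)).comp
        (ContinuousLinearMap.inl ℝ E E)) (chartOne E G (k (chartOne E G 1))) := by
    rw [hk]
    exact hasFDerivAt_chartMul_left hl
  refine (hleft.comp (chartOne E G 1) (hasFDerivAt_conj_chartOne y)).unique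
    ((hasFDerivAt_chartMul_right hr).congr_of_eventuallyEq ?_)
  have hcont : ContinuousAt k (chartOne E G 1) :=
    (contMDiff_conj (E := E) y).continuous.continuousAt.comp (continuousAt_extChartAt_symm 1)
  have hnhds : (chartOne E G).source ∈ nhds (k (chartOne E G 1)) := by
    rw [hk]
    exact extChartAt_source_mem_nhds 1
  filter_upwards [hcont.preimage_mem_nhds hnhds] with x hx
  have hx' : k x ∈ (chartOne E G).source := hx
  simp only [Function.comp_apply, chartMul, (chartOne E G).left_inv hy]
  rw [(chartOne E G).left_inv hx']
  simp [k]

theorem hasMFDerivAt_adjointCLM [CompleteSpace E] :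
    HasMFDerivAt 𝓘(ℝ, E) 𝓘(ℝ, E →L[ℝ] E) (adjointCLM E : G → E →L[ℝ] E) 1
      (chartMulMixed E G - (chartMulMixed E G).flip) := by
  have : IsManifold 𝓘(ℝ, E) 1 G := IsManifold.of_le (n := ∞) (by simp)
  have hF : HasFDerivAt (fun x => adjointCLM E ((chartOne E G).symm x))
      (chartMulMixed E G - (chartMulMixed E G).flip) (chartOne E G 1) := by
    refine hasFDerivAt_of_mul_eq hasFDerivAt_fderiv_chartMul_inl hasFDerivAt_fderiv_chartMul_inr
      fderiv_chartMul_one_inl fderiv_chartMul_one_inr ?_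
    filter_upwards [extChartAt_target_mem_nhds (I := 𝓘(ℝ, E)) (1 : G),
      eventually_differentiableAt_chartMul tendsto_const_nhds Filter.tendsto_id,
      eventually_differentiableAt_chartMul Filter.tendsto_id tendsto_const_nhds] with x hx hl hr
    have hcomp := chartMul_comp_adjointCLM ((chartOne E G).map_target hx)
    rw [(chartOne E G).right_inv hx] at hcomp
    exact hcomp hl hr
  refine (hF.hasMFDerivAt.comp 1 (hasMFDerivAt_extChartAt_self (1 : G))).congr_of_eventuallyEq ?_
  filter_upwards [extChartAt_source_mem_nhds (I := 𝓘(ℝ, E)) (1 : G)] with y hy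
  rw [Function.comp_apply, (chartOne E G).left_inv hy]

theorem hasDerivAt_adjointCLM_comp [CompleteSpace E] {c : ℝ → G} {v : E} (hc0 : c 0 = 1)
    (hc : MDifferentiableAt 𝓘(ℝ, ℝ) 𝓘(ℝ, E) c 0)
    (hcv : (mfderiv 𝓘(ℝ, ℝ) 𝓘(ℝ, E) c 0 (1 : ℝ) : E) = v) :
    HasDerivAt (fun s => adjointCLM E (c s))
      (chartMulMixed E G v - (chartMulMixed E G).flip v) 0 := by
  have hAd := hasMFDerivAt_adjointCLM (E := E) (G := G)
  rw [← hc0] at hAd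
  have hcomp : HasFDerivAt (fun s => adjointCLM E (c s))
      ((chartMulMixed E G - (chartMulMixed E G).flip).comp
        (mfderiv 𝓘(ℝ, ℝ) 𝓘(ℝ, E) c 0 : ℝ →L[ℝ] E)) 0 :=
    (HasMFDerivAt.comp (f := c) 0 hAd hc.hasMFDerivAt).hasFDerivAt
  refine hcomp.hasDerivAt.congr_deriv ?_
  rw [← hcv]
  rfl

theorem adjointCLM_eq_exp [CompleteSpace E] {Y : GroupLieAlgebra 𝓘(ℝ, E) G} {y : G}
    (hy : IsExp Y y) :
    adjointCLM E y = NormedSpace.exp (chartMulMixed E G Y - (chartMulMixed E G).flip Y) := by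
  obtain ⟨c, hc, hadd, hcY, rfl⟩ := hy
  have hc0 : c 0 = 1 := by simpa using hadd 0 0
  have hderiv := hasDerivAt_adjointCLM_comp hc0 (hc.mdifferentiableAt (by simp)) hcY
  have hexp := eq_exp_smul_of_map_add hderiv (by rw [hc0, adjointCLM_one])
    (fun s t => by rw [hadd, adjointCLM_mul]) 1
  rwa [one_smul] at hexp

instance [FiniteDimensional ℝ E] : FiniteDimensional ℝ (GroupLieAlgebra 𝓘(ℝ, E) G) :=
  inferInstanceAs (FiniteDimensional ℝ E)

theorem IsExp.differential_conj_apply [FiniteDimensional ℝ E] {Y : GroupLieAlgebra 𝓘(ℝ, E) G}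
    {y : G} (hy : IsExp Y y) (Z : GroupLieAlgebra 𝓘(ℝ, E) G) :
    differential E (MulAut.conj y) Z = expAd Y Z := by
  have := FiniteDimensional.complete ℝ E
  let A : Module.End ℝ E := LieAlgebra.ad ℝ (GroupLieAlgebra 𝓘(ℝ, E) G) Y
  have had : (chartMulMixed E G Y - (chartMulMixed E G).flip Y : E →L[ℝ] E) =
      LinearMap.toContinuousLinearMap A := by
    ext W
    exact (lie_eq_chartMulMixed_sub Y W).symm
  have hexp : adjointCLM E y = LinearMap.toContinuousLinearMap (expEnd A) :=
    (adjointCLM_eq_exp hy).trans <|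
      (congrArg NormedSpace.exp had).trans (toContinuousLinearMap_expEnd A).symm
  exact DFunLike.congr_fun hexp Z

end Adjoint

theorem sigmaAt_zero {V : Type*} [AddCommGroup V] [Module ℝ V] (B : LinearMap.BilinForm ℝ V)
    (Δ : Set V) : sigmaAt B Δ 0 = Δ :=
  Set.Subset.antisymm (fun _ hl => hl.1) fun _ hl => ⟨hl, 0, by simp⟩

section Involution

variable {E : Type*} [NormedAddCommGroup E] [NormedSpace ℝ E]
  {G : Type*} [TopologicalSpace G] [ChartedSpace E G] [Group G] {θ θ₁ θ₂ : MulAut G}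

theorem IsInvolution.inv_eq (hθ : IsInvolution E θ) : θ⁻¹ = θ :=
  inv_eq_of_mul_eq_one_right hθ.mul_self

theorem differential_comm (hθ₁ : ContMDiff 𝓘(ℝ, E) 𝓘(ℝ, E) ∞ θ₁)
    (hθ₂ : ContMDiff 𝓘(ℝ, E) 𝓘(ℝ, E) ∞ θ₂) (hcomm : Commute θ₁ θ₂)
    (X : GroupLieAlgebra 𝓘(ℝ, E) G) :
    differential E θ₁ (differential E θ₂ X) = differential E θ₂ (differential E θ₁ X) := by
  rw [← differential_mul_apply hθ₁ hθ₂, hcomm.eq, differential_mul_apply hθ₂ hθ₁]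

variable [LieGroup 𝓘(ℝ, E) ∞ G]

theorem IsExp.differential_expAd_of_conj [FiniteDimensional ℝ E]
    {Y : GroupLieAlgebra 𝓘(ℝ, E) G} {y : G} (hy : IsExp Y y)
    (hθ₁ : ContMDiff 𝓘(ℝ, E) 𝓘(ℝ, E) ∞ θ₁) (hθ₂ : ContMDiff 𝓘(ℝ, E) 𝓘(ℝ, E) ∞ θ₂)
    (hconj : θ₂ = MulAut.conj y * θ₁ * (MulAut.conj y)⁻¹) (X : GroupLieAlgebra 𝓘(ℝ, E) G) :
    differential E θ₂ (expAd Y X) = expAd Y (differential E θ₁ X) := by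
  rw [← hy.differential_conj_apply, ← hy.differential_conj_apply,
    ← differential_mul_apply hθ₂ (contMDiff_conj y),
    ← differential_mul_apply (contMDiff_conj y) hθ₁, eq_mul_inv_iff_mul_eq.1 hconj]

theorem IsExp.conj_eq_one_of_zero [FiniteDimensional ℝ E] [PreconnectedSpace G] {y : G}
    (hy : IsExp (0 : GroupLieAlgebra 𝓘(ℝ, E) G) y) : MulAut.conj y = 1 :=
  eq_one_of_differential_eq_id (contMDiff_conj (E := E) y) <| LinearMap.ext fun Z =>
    (hy.differential_conj_apply Z).trans (expAd_zero_apply Z)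

namespace IsInvolution

variable [CompleteSpace E]

/-- The differential of an involution of a Lie group, as an endomorphism of the Lie algebra. -/
noncomputable def lieHom (hθ : IsInvolution E θ) :
    GroupLieAlgebra 𝓘(ℝ, E) G →ₗ⁅ℝ⁆ GroupLieAlgebra 𝓘(ℝ, E) G :=
  differentialLieHom E θ hθ.contMDiff (by rw [hθ.inv_eq]; exact hθ.contMDiff)

theorem coe_lieHom (hθ : IsInvolution E θ) :
    (hθ.lieHom : GroupLieAlgebra 𝓘(ℝ, E) G →ₗ[ℝ] GroupLieAlgebra 𝓘(ℝ, E) G) = differential E θ :=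
  rfl

theorem lieHom_ne_id [PreconnectedSpace G] (hθ : IsInvolution E θ) : hθ.lieHom ≠ LieHom.id :=
  fun h => hθ.ne_one <| eq_one_of_differential_eq_id hθ.contMDiff <|
    LinearMap.ext fun X => LieHom.congr_fun h X

theorem isSymmetricPair (hθ : IsInvolution E θ)
    {B : LinearMap.BilinForm ℝ (GroupLieAlgebra 𝓘(ℝ, E) G)} (hB : IsInvariantInnerProduct B)
    {a : Submodule ℝ (GroupLieAlgebra 𝓘(ℝ, E) G)}
    (ha : IsMaximalAbelian (minusPart (differential E θ)) a) : IsSymmetricPair B hθ.lieHom a where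
  inner := hB
  involutive X := by
    refine (differential_mul_apply hθ.contMDiff hθ.contMDiff X).symm.trans ?_
    rw [hθ.mul_self, differential_one, LinearMap.id_apply]
  maximal := ha

end IsInvolution

end Involution

end SymTriad

theorem mainTheorem9
    {E : Type*} [NormedAddCommGroup E] [NormedSpace ℝ E] [FiniteDimensional ℝ E]
    {G : Type*} [TopologicalSpace G] [ChartedSpace E G] [Group G] [LieGroup 𝓘(ℝ, E) ∞ G]
    [T2Space G] [CompactSpace G] [ConnectedSpace G]
    (hsimple : LieAlgebra.IsSimple ℝ (GroupLieAlgebra 𝓘(ℝ, E) G))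
    (B : LinearMap.BilinForm ℝ (GroupLieAlgebra 𝓘(ℝ, E) G)) (hB : IsInvariantInnerProduct B)
    (θ₁ θ₂ : MulAut G) (hθ₁ : IsInvolution E θ₁) (hθ₂ : IsInvolution E θ₂)
    (hcomm : Commute θ₁ θ₂)
    (a : Submodule ℝ (GroupLieAlgebra 𝓘(ℝ, E) G))
    (ha : IsMaximalAbelian (minusPart (differential E θ₁)) a)
    (Y : GroupLieAlgebra 𝓘(ℝ, E) G) (hY : Y ∈ a) (y : G) (hy : IsExp Y y)
    (hconj : θ₂ = MulAut.conj y * θ₁ * (MulAut.conj y)⁻¹) :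
    IsMaximalAbelian (minusPart (differential E θ₁) ⊓ minusPart (differential E θ₂)) a ∧
    Y ∈ latticeΓ B a (restrictedRoots B a) ∧
    IsTypeIV B a (triadOf B a (differential E θ₁) (differential E θ₂)) ∧
    IsTypeIVWith B a (triadOf B a (differential E θ₁) (differential E θ₂))
      (restrictedRoots B a) (restrictedMult B a) Y ∧
    (Y = 0 → θ₁ = θ₂ ∧
      (triadOf B a (differential E θ₁) (differential E θ₂)).tildeSigma = restrictedRoots B a ∧
      (triadOf B a (differential E θ₁) (differential E θ₂)).sigma = restrictedRoots B a ∧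
      (triadOf B a (differential E θ₁) (differential E θ₂)).w = ∅) := by
  have := hsimple
  have := FiniteDimensional.complete ℝ E
  have hpair := hθ₁.isSymmetricPair hB ha
  have hconj' : ∀ X, hθ₂.lieHom (expAd Y X) = expAd Y (hθ₁.lieHom X) :=
    hy.differential_expAd_of_conj hθ₁.contMDiff hθ₂.contMDiff hconj
  have hcomm' : ∀ X, hθ₁.lieHom (hθ₂.lieHom X) = hθ₂.lieHom (hθ₁.lieHom X) :=
    differential_comm hθ₁.contMDiff hθ₂.contMDiff hcomm
  have hmaximal := hpair.isMaximalAbelian_inf hY hconj'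
  have htriad := hpair.isTypeIVWith hY hconj' hθ₁.lieHom_ne_id hcomm'
  simp only [IsInvolution.coe_lieHom] at hmaximal htriad
  refine ⟨hmaximal, hpair.mem_latticeΓ hY hconj' hcomm',
    ⟨restrictedMult B a, Y, htriad⟩, htriad, ?_⟩
  rintro rfl
  refine ⟨?_, rfl, htriad.sigma_eq.trans (sigmaAt_zero B _), ?_⟩
  · rw [hconj, hy.conj_eq_one_of_zero, one_mul, inv_one, mul_one]
  · exact htriad.w_eq_diff.trans (by rw [sigmaAt_zero, Set.sdiff_self])
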